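/- (Smooth universal convex-split lemma on separable Hilbert spaces.) Let $\mathcal{H}_A,\mathcal{H}_E$ be separable complex Hilbert spaces. A state is a positive semidefinite operator of trace one. For states $\rho,\sigma$ let $F(\rho,\sigma)=\|\sqrt{\rho}\sqrt{\sigma}\|_1^2$ be the fidelity, $P(\rho,\sigma)=\sqrt{1-F(\rho,\sigma)}$ the sine distance, and $D_{\max}(\rho\|\sigma)=\inf\{\lambda\in\mathbb{R}:\rho\le 2^{\lambda}\sigma\}$ (with $\inf\emptyset=+\infty$). For a state $\rho_{AE}$ on $\mathcal{H}_A\otimes\mathcal{H}_E$ with marginals $\rho_A=\operatorname{Tr}_E[\rho_{AE}]$, $\rho_E=\operatorname{Tr}_A[\rho_{AE}]$, and for $\delta\in[0,1]$, let $$\widetilde{I}_{\max}^{\delta}(E;A)_{\rho}=\inf_{\widetilde{\rho}_{AE}:\,P(\widetilde{\rho}_{AE},\rho_{AE})\le\delta}D_{\max}(\widetilde{\rho}_{AE}\,\|\,\rho_A\otimes\widetilde{\rho}_E),$$ where the infimum is over states $\widetilde{\rho}_{AE}$ and $\widetilde{\rho}_E=\operatorname{Tr}_A[\widetilde{\rho}_{AE}]$.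 Let $\mathcal{S}$ be a set and, for every $s\in\mathcal{S}$, let $\rho^s_{AE}$ be a state on $\mathcal{H}_A\otimes\mathcal{H}_E$ such that $\operatorname{Tr}_E[\rho^s_{AE}]=\rho_A$ does not depend on $s$. Let $R\ge 1$ be an integer, let $A_1,\dots,A_R$ be copies of $A$, and let $$\tau^s_{A_1\cdots A_RE}=\frac{1}{R}\sum_{r=1}^{R}\rho_{A_1}\otimes\cdots\otimes\rho_{A_{r-1}}\otimes\rho^s_{A_rE}\otimes\rho_{A_{r+1}}\otimes\cdots\otimes\rho_{A_R}$$ be the convex-split state. Let $\varepsilon\in(0,1)$ and $\eta\in(0,\sqrt{\varepsilon})$. If $$\log_2 R\ \ge\ \sup_{s\in\mathcal{S}}\widetilde{I}_{\max}^{\sqrt{\varepsilon}-\eta}(E;A)_{\rho^s}+2\log_2\!\Big(\frac{1}{2\eta}\Big),$$ then for every $s\in\mathcal{S}$ there exists a state $\widetilde{\rho}^s_E$ on $\mathcal{H}_E$ such that $$\frac12\Big\|\tau^s_{A_1\cdots A_RE}-\rho_{A_1}\otimes\cdots\otimes\rho_{A_R}\otimes\widetilde{\rho}^s_E\Big\|_1\le\sqrt{\varepsilon}\qquad\text{and}\qquad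 P(\widetilde{\rho}^s_E,\rho^s_E)\le\sqrt{\varepsilon}-\eta.$$ -/

import Mathlib

open UniformSpace
open scoped TensorProduct ENNReal

universe u

noncomputable section

namespace ConvexSplit

/-! ### Traces, states and distinguishability measures on a Hilbert space -/

section SingleSystem

variable {H : Type*} [NormedAddCommGroup H] [InnerProductSpace ℂ H]

theorem tsum_enorm_inner_sq {ι : Type*} (b : HilbertBasis ι ℂ H) (x : H) :
    ∑' i, ‖inner ℂ (b i) x‖ₑ ^ 2 = ‖x‖ₑ ^ 2 := by
  have h := b.hasSum_inner_mul_inner x x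
  have h2 : HasSum (fun i => ‖inner ℂ (b i) x‖ ^ 2) (‖x‖ ^ 2) := by
    have h3 := (Complex.hasSum_iff _ _).1 h |>.1
    have e : ∀ i, (inner ℂ x (b i) * inner ℂ (b i) x).re = ‖inner ℂ (b i) x‖ ^ 2 := by
      intro i
      rw [← inner_conj_symm x (b i), ← Complex.normSq_eq_conj_mul_self, Complex.ofReal_re,
        Complex.normSq_eq_norm_sq]
    have e2 : (inner ℂ x x).re = ‖x‖ ^ 2 := inner_self_eq_norm_sq (𝕜 := ℂ) x
    simpa only [e, e2] using h3
  have h4 := h2.tsum_eq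
  have key : ∀ y : ℝ, 0 ≤ y → ENNReal.ofReal (y ^ 2) = ENNReal.ofReal y ^ 2 :=
    fun y hy => ENNReal.ofReal_pow hy 2
  calc ∑' i, ‖inner ℂ (b i) x‖ₑ ^ 2 = ∑' i, ENNReal.ofReal (‖inner ℂ (b i) x‖ ^ 2) := by
        refine tsum_congr fun i => ?_
        rw [key _ (norm_nonneg _), ofReal_norm]
    _ = ENNReal.ofReal (∑' i, ‖inner ℂ (b i) x‖ ^ 2) :=
        (ENNReal.ofReal_tsum_of_nonneg (fun i => by positivity) h2.summable).symm
    _ = ‖x‖ₑ ^ 2 := by rw [h4, key _ (norm_nonneg _), ofReal_norm]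

variable [CompleteSpace H]

variable (H) in
/-- The index set of some fixed orthonormal (Hilbert) basis of `H`. -/
def basisIndex : Set H := (exists_hilbertBasis ℂ H).choose

variable (H) in
/-- Some fixed orthonormal (Hilbert) basis of `H`. -/
def stdBasis : HilbertBasis (basisIndex H) ℂ H := (exists_hilbertBasis ℂ H).choose_spec.choose

/-- The trace `∑ i, ⟪e i, T (e i)⟫ ∈ [0, ∞]` of a positive semidefinite bounded operator `T`;
it does not depend on the orthonormal basis, see `posTrace_eq`. -/
def posTrace (T : H →L[ℂ] H) : ℝ≥0∞ :=
  ∑' i, ENNReal.ofReal (inner ℂ (stdBasis H i) (T (stdBasis H i))).re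

theorem tsum_enorm_apply_sq_eq {ι κ : Type*} (b : HilbertBasis ι ℂ H) (c : HilbertBasis κ ℂ H)
    (S : H →L[ℂ] H) (hS : IsSelfAdjoint S) :
    ∑' i, ‖S (b i)‖ₑ ^ 2 = ∑' j, ‖S (c j)‖ₑ ^ 2 := by
  have hsym : ∀ x y, inner ℂ (S x) y = inner ℂ x (S y) :=
    (ContinuousLinearMap.isSelfAdjoint_iff_isSymmetric.1 hS)
  calc ∑' i, ‖S (b i)‖ₑ ^ 2 = ∑' i, ∑' j, ‖inner ℂ (c j) (S (b i))‖ₑ ^ 2 :=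
        tsum_congr fun i => (tsum_enorm_inner_sq c _).symm
    _ = ∑' j, ∑' i, ‖inner ℂ (c j) (S (b i))‖ₑ ^ 2 := ENNReal.tsum_comm
    _ = ∑' j, ∑' i, ‖inner ℂ (b i) (S (c j))‖ₑ ^ 2 := by
        refine tsum_congr fun j => tsum_congr fun i => ?_
        rw [← hsym, ← ofReal_norm, ← ofReal_norm, norm_inner_symm]
    _ = ∑' j, ‖S (c j)‖ₑ ^ 2 := tsum_congr fun j => tsum_enorm_inner_sq b _

/-- Basis independence of the trace of a positive semidefinite operator. -/
theorem posTrace_eq {ι : Type*} (b : HilbertBasis ι ℂ H) {T : H →L[ℂ] H} (hT : 0 ≤ T) :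
    posTrace T = ∑' i, ENNReal.ofReal (inner ℂ (b i) (T (b i))).re := by
  have hS : IsSelfAdjoint (CFC.sqrt T) := (CFC.sqrt_nonneg T).isSelfAdjoint
  have hsym : ∀ x y, inner ℂ (CFC.sqrt T x) y = inner ℂ x (CFC.sqrt T y) :=
    (ContinuousLinearMap.isSelfAdjoint_iff_isSymmetric.1 hS)
  have hmul : CFC.sqrt T * CFC.sqrt T = T := CFC.sqrt_mul_sqrt_self T hT
  have key : ∀ x : H, ENNReal.ofReal (inner ℂ x (T x)).re = ‖CFC.sqrt T x‖ₑ ^ 2 := by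
    intro x
    have : inner ℂ x (T x) = inner ℂ (CFC.sqrt T x) (CFC.sqrt T x) := by
      conv_lhs => rw [← hmul]
      rw [hsym]; rfl
    rw [this]
    have e2 : (inner ℂ (CFC.sqrt T x) (CFC.sqrt T x)).re = ‖CFC.sqrt T x‖ ^ 2 :=
      inner_self_eq_norm_sq (𝕜 := ℂ) _
    rw [e2, ENNReal.ofReal_pow (norm_nonneg _), ofReal_norm]
  unfold posTrace
  simp only [key]
  exact tsum_enorm_apply_sq_eq _ _ _ hS

/-- The trace norm `‖T‖₁ = Tr |T| ∈ [0, ∞]`, where `|T| = √(T† T)`. -/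
def traceNorm (T : H →L[ℂ] H) : ℝ≥0∞ := posTrace (CFC.abs T)

/-- A quantum state (density operator): positive semidefinite with unit trace. -/
def IsState (ρ : H →L[ℂ] H) : Prop := 0 ≤ ρ ∧ posTrace ρ = 1

/-- The fidelity `F(ρ, σ) = ‖√ρ √σ‖₁ ^ 2` of two states. -/
def fidelity (ρ σ : H →L[ℂ] H) : ℝ := (traceNorm (CFC.sqrt ρ * CFC.sqrt σ)).toReal ^ 2

/-- The sine distance `P(ρ, σ) = √(1 - F(ρ, σ))` of two states. -/
def sineDist (ρ σ : H →L[ℂ] H) : ℝ := √(1 - fidelity ρ σ)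

/-- The max-relative entropy `D_max(ρ‖σ) = inf {r : ρ ≤ 2 ^ r σ}`, equal to `⊤` if there is
no such real `r`. The order is the Loewner order. -/
def dMax (ρ σ : H →L[ℂ] H) : EReal :=
  ⨅ (r : ℝ) (_ : ρ ≤ (((2 : ℝ) ^ r : ℝ) : ℂ) • σ), (r : EReal)

end SingleSystem

/-! ### Bipartite systems -/

section Bipartite

variable (A E : Type*) [NormedAddCommGroup A] [InnerProductSpace ℂ A]
  [NormedAddCommGroup E] [InnerProductSpace ℂ E]

/-- The Hilbert space tensor product: the completion of the algebraic tensor product with respect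
to the inner product `⟪a ⊗ e, a' ⊗ e'⟫ = ⟪a, a'⟫ * ⟪e, e'⟫`. -/
abbrev HTensor : Type _ := Completion (A ⊗[ℂ] E)

variable {A E}

/-- The tensor product `S ⊗ T` of two bounded operators. -/
def opTensor (S : A →L[ℂ] A) (T : E →L[ℂ] E) : HTensor A E →L[ℂ] HTensor A E :=
  (TensorProduct.mapL S T).completion

/-- The operator `a ↦ a ⊗ e`. -/
def sliceRight (e : E) : A →L[ℂ] HTensor A E :=
  Completion.toComplL ∘L (TensorProduct.mkL ℂ A E).flip e

/-- The operator `e ↦ a ⊗ e`. -/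
def sliceLeft (a : A) : E →L[ℂ] HTensor A E :=
  Completion.toComplL ∘L TensorProduct.mkL ℂ A E a

variable [CompleteSpace A] [CompleteSpace E]

/-- The partial trace over the second factor, `Tr_E[T] = ∑ j, (1 ⊗ ⟨e j|) T (1 ⊗ |e j⟩)`
for an orthonormal basis `e` of `E`. The series converges in norm if `T` is trace class. -/
def traceOutRight (T : HTensor A E →L[ℂ] HTensor A E) : A →L[ℂ] A :=
  ∑' j, (sliceRight (stdBasis E j)).adjoint ∘L T ∘L sliceRight (stdBasis E j)

/-- The partial trace over the first factor, `Tr_A[T] = ∑ i, (⟨a i| ⊗ 1) T (|a i⟩ ⊗ 1)`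
for an orthonormal basis `a` of `A`. The series converges in norm if `T` is trace class. -/
def traceOutLeft (T : HTensor A E →L[ℂ] HTensor A E) : E →L[ℂ] E :=
  ∑' i, (sliceLeft (stdBasis A i)).adjoint ∘L T ∘L sliceLeft (stdBasis A i)

/-- The alternate smooth max-mutual information
`Ĩ_max^δ(E;A)_ρ = inf D_max(ρ' ‖ ρ_A ⊗ ρ'_E)` over all states `ρ'` with `P(ρ', ρ) ≤ δ`. -/
def smoothMaxMI (δ : ℝ) (ρ : HTensor A E →L[ℂ] HTensor A E) : EReal :=
  ⨅ (ρ' : HTensor A E →L[ℂ] HTensor A E) (_ : IsState ρ') (_ : sineDist ρ' ρ ≤ δ),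
    dMax ρ' (opTensor (traceOutRight ρ) (traceOutLeft ρ'))

end Bipartite

/-! ### Multipartite systems and the convex-split state -/

/-- A bundled complex inner product space (not necessarily complete). -/
structure InnerSpace where
  carrier : Type u
  [group : NormedAddCommGroup carrier]
  [inner : InnerProductSpace ℂ carrier]

attribute [instance] InnerSpace.group InnerSpace.inner

section Multipartite

variable (A E : Type u) [NormedAddCommGroup A] [InnerProductSpace ℂ A]
  [NormedAddCommGroup E] [InnerProductSpace ℂ E]

/-- The algebraic tensor product `A ⊗ (A ⊗ (⋯ ⊗ (A ⊗ E)))` with `n` factors `A`. -/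
def algPow : ℕ → InnerSpace.{u}
  | 0 => ⟨E⟩
  | n + 1 => ⟨A ⊗[ℂ] (algPow n).carrier⟩

/-- The Hilbert space `A₁ ⊗ ⋯ ⊗ Aₙ ⊗ E` in which all the `Aᵢ` are copies of `A`. -/
abbrev HPow (n : ℕ) : Type u := Completion (algPow A E n).carrier

variable {A}

variable {E} in
/-- `σ ⊗ ⋯ ⊗ σ ⊗ T`, with `n` factors `σ`, on the algebraic tensor product. -/
def algPowMap (σ : A →L[ℂ] A) (T : E →L[ℂ] E) :
    (n : ℕ) → ((algPow A E n).carrier →L[ℂ] (algPow A E n).carrier)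
  | 0 => T
  | n + 1 => TensorProduct.mapL σ (algPowMap σ T n)

variable {E} in
/-- The operator `σ ⊗ ⋯ ⊗ σ ⊗ T` on `A₁ ⊗ ⋯ ⊗ Aₙ ⊗ E`, with `n` factors `σ`. -/
def tensorPowOp (n : ℕ) (σ : A →L[ℂ] A) (T : E →L[ℂ] E) : HPow A E n →L[ℂ] HPow A E n :=
  (algPowMap σ T n).completion

variable (A)

/-- The reordering `A₁ ⊗ ⋯ ⊗ Aₙ ⊗ (B ⊗ E) ≃ B ⊗ (A₁ ⊗ ⋯ ⊗ Aₙ ⊗ E)`, all `Aᵢ` and `B` being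
copies of `A`. -/
def pullFront : (n : ℕ) →
    ((algPow A (A ⊗[ℂ] E) n).carrier ≃ₗᵢ[ℂ] A ⊗[ℂ] (algPow A E n).carrier)
  | 0 => LinearIsometryEquiv.refl ℂ _
  | n + 1 =>
    (((pullFront n).lTensor A).trans
      (TensorProduct.assocIsometry ℂ A A (algPow A E n).carrier).symm).trans
      (((TensorProduct.commIsometry ℂ A A).rTensor (algPow A E n).carrier).trans
        (TensorProduct.assocIsometry ℂ A A (algPow A E n).carrier))

/-- The reordering `A₁ ⊗ ⋯ ⊗ Aₙ ⊗ (B ⊗ E) ≃ A₁ ⊗ ⋯ ⊗ B ⊗ ⋯ ⊗ Aₙ ⊗ E`, all `Aᵢ` and `B` being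
copies of `A`, that puts the factor `B` into position `r` (counted from `0`). -/
def insertAt : (n : ℕ) → Fin (n + 1) →
    ((algPow A (A ⊗[ℂ] E) n).carrier ≃ₗᵢ[ℂ] (algPow A E (n + 1)).carrier)
  | 0, _ => pullFront A E 0
  | n + 1, r =>
    Fin.cases (motive := fun _ => (algPow A (A ⊗[ℂ] E) (n + 1)).carrier ≃ₗᵢ[ℂ]
        (algPow A E (n + 2)).carrier)
      (pullFront A E (n + 1)) (fun r' => (insertAt n r').lTensor A) r

/-- The isometric inclusion of the algebraic tensor product `A ⊗ ⋯ ⊗ A ⊗ (A ⊗ E)` into the one in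
which the last factor has been replaced by its completion. -/
def completeLast : (n : ℕ) →
    ((algPow A (A ⊗[ℂ] E) n).carrier →ₗᵢ[ℂ] (algPow A (HTensor A E) n).carrier)
  | 0 => Completion.toComplₗᵢ
  | n + 1 => (completeLast n).lTensor A

theorem denseRange_completeLast : ∀ n, DenseRange (completeLast A E n)
  | 0 => Completion.denseRange_coe
  | n + 1 => by
    have ih := denseRange_completeLast n
    have hsub : ∀ z : A ⊗[ℂ] (algPow A (HTensor A E) n).carrier,
        z ∈ (LinearMap.range ((completeLast A E n).lTensor A).toLinearMap).topologicalClosure := by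
      intro z
      induction z using TensorProduct.induction_on with
      | zero => exact Submodule.zero_mem _
      | add x y hx hy => exact Submodule.add_mem _ hx hy
      | tmul a y =>
        have hc : Continuous fun y : (algPow A (HTensor A E) n).carrier => a ⊗ₜ[ℂ] y :=
          (TensorProduct.mkL ℂ A _ a).continuous
        refine closure_minimal ?_ (IsClosed.preimage hc
          (Submodule.isClosed_topologicalClosure _)) (ih y)
        rintro _ ⟨x, rfl⟩
        exact Submodule.le_topologicalClosure _ ⟨a ⊗ₜ[ℂ] x, rfl⟩
    exact hsub

/-- The unitary `A₁ ⊗ ⋯ ⊗ Aₙ ⊗ (B ⊗ E) ≃ A₁ ⊗ ⋯ ⊗ B ⊗ ⋯ ⊗ Aₙ ⊗ E` of Hilbert spaces that puts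
the factor `B` into position `r`. -/
def placeEquiv (n : ℕ) (r : Fin (n + 1)) :
    HPow A (HTensor A E) n ≃ₗᵢ[ℂ] HPow A E (n + 1) :=
  (insertAt A E n r).toLinearEquiv.extendOfIsometry
    (Completion.toComplₗᵢ.toLinearMap ∘ₗ (completeLast A E n).toLinearMap)
    Completion.toComplₗᵢ.toLinearMap
    (Completion.denseRange_coe.comp (denseRange_completeLast A E n)
      (Completion.continuous_coe _))
    Completion.denseRange_coe
    (fun x => by simp)

variable {A E}

/-- The elementary tensor `a₁ ⊗ ⋯ ⊗ aₙ ⊗ e`. -/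
def algTmul (e : E) : (n : ℕ) → (Fin n → A) → (algPow A E n).carrier
  | 0, _ => e
  | n + 1, a => a 0 ⊗ₜ[ℂ] algTmul e n (Fin.tail a)

theorem pullFront_algTmul (b : A) (e : E) : ∀ (n : ℕ) (a : Fin n → A),
    pullFront A E n (algTmul (b ⊗ₜ[ℂ] e) n a) = b ⊗ₜ[ℂ] algTmul e n a
  | 0, _ => rfl
  | n + 1, a => by
    have ih := pullFront_algTmul b e n (Fin.tail a)
    have h : (pullFront A E n).lTensor A (algTmul (b ⊗ₜ[ℂ] e) (n + 1) a)
        = a 0 ⊗ₜ[ℂ] (b ⊗ₜ[ℂ] algTmul e n (Fin.tail a)) := by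
      rw [← ih]; rfl
    change TensorProduct.assocIsometry ℂ A A (algPow A E n).carrier
      ((TensorProduct.commIsometry ℂ A A).rTensor (algPow A E n).carrier
        ((TensorProduct.assocIsometry ℂ A A (algPow A E n).carrier).symm
          ((pullFront A E n).lTensor A (algTmul (b ⊗ₜ[ℂ] e) (n + 1) a)))) = _
    rw [h]
    rfl

theorem insertAt_algTmul (b : A) (e : E) : ∀ (n : ℕ) (r : Fin (n + 1)) (a : Fin n → A),
    insertAt A E n r (algTmul (b ⊗ₜ[ℂ] e) n a)
      = algTmul e (n + 1) (Fin.insertNth (α := fun _ => A) r b a)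
  | 0, r, a => by
    obtain rfl : r = 0 := Fin.ext (by omega)
    rw [Fin.insertNth_zero]; rfl
  | n + 1, r, a => by
    induction r using Fin.cases with
    | zero =>
      rw [Fin.insertNth_zero]
      exact pullFront_algTmul b e (n + 1) a
    | succ r' =>
      have ih := insertAt_algTmul b e n r' (Fin.tail a)
      have h1 : Fin.insertNth (α := fun _ => A) r'.succ b a
          = Fin.cons (α := fun _ => A) (a 0)
            (Fin.insertNth (α := fun _ => A) r' b (Fin.tail a)) := by
        conv_lhs => rw [← Fin.cons_self_tail a]
        exact Fin.insertNth_succ_cons ..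
      rw [h1]
      change a 0 ⊗ₜ[ℂ] insertAt A E n r' (algTmul (b ⊗ₜ[ℂ] e) n (Fin.tail a)) = _
      rw [ih]; rfl

theorem completeLast_algTmul (x : A ⊗[ℂ] E) : ∀ (n : ℕ) (a : Fin n → A),
    completeLast A E n (algTmul x n a) = algTmul (x : HTensor A E) n a
  | 0, _ => rfl
  | n + 1, a => by
    change a 0 ⊗ₜ[ℂ] completeLast A E n (algTmul x n (Fin.tail a)) = _
    rw [completeLast_algTmul x n (Fin.tail a)]; rfl

/-- `placeEquiv` maps `a₁ ⊗ ⋯ ⊗ aₙ ⊗ (b ⊗ e)` to `a₁ ⊗ ⋯ ⊗ b ⊗ ⋯ ⊗ aₙ ⊗ e`. -/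
theorem placeEquiv_algTmul (n : ℕ) (r : Fin (n + 1)) (a : Fin n → A) (b : A) (e : E) :
    placeEquiv A E n r (algTmul ((b ⊗ₜ[ℂ] e : A ⊗[ℂ] E) : HTensor A E) n a :
        (algPow A (HTensor A E) n).carrier)
      = (algTmul e (n + 1) (Fin.insertNth (α := fun _ => A) r b a) :
        (algPow A E (n + 1)).carrier) := by
  rw [← insertAt_algTmul, ← completeLast_algTmul]
  exact LinearEquiv.extendOfIsometry_eq (insertAt A E n r).toLinearEquiv _ _ _ _ _
    (algTmul (b ⊗ₜ[ℂ] e) n a)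

/-- The operator `σ_{A₁} ⊗ ⋯ ⊗ T_{AᵣE} ⊗ ⋯ ⊗ σ_{Aₙ₊₁}` on `A₁ ⊗ ⋯ ⊗ Aₙ₊₁ ⊗ E`: the bipartite
operator `T` acts on `E` and on the copy of `A` in position `r`, and `σ` on every other copy. -/
def placeOp (n : ℕ) (r : Fin (n + 1)) (σ : A →L[ℂ] A)
    (T : HTensor A E →L[ℂ] HTensor A E) : HPow A E (n + 1) →L[ℂ] HPow A E (n + 1) :=
  (placeEquiv A E n r : HPow A (HTensor A E) n →L[ℂ] HPow A E (n + 1)) ∘L tensorPowOp n σ T ∘L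
    ((placeEquiv A E n r).symm : HPow A E (n + 1) →L[ℂ] HPow A (HTensor A E) n)

/-- The convex-split state
`τ = (1/R) ∑ r, σ_{A₁} ⊗ ⋯ ⊗ σ_{Aᵣ₋₁} ⊗ ρ_{AᵣE} ⊗ σ_{Aᵣ₊₁} ⊗ ⋯ ⊗ σ_{A_R}`
on `A₁ ⊗ ⋯ ⊗ A_R ⊗ E` (for `R = 0` the empty sum). -/
def convexSplit (σ : A →L[ℂ] A) (ρ : HTensor A E →L[ℂ] HTensor A E) :
    (R : ℕ) → (HPow A E R →L[ℂ] HPow A E R)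
  | 0 => 0
  | n + 1 => (1 / ((n + 1 : ℕ) : ℂ)) • ∑ r : Fin (n + 1), placeOp n r σ ρ

end Multipartite

end ConvexSplit

end

/-! Write `σ = ρ_A`. Choose a nearly optimal `ρ'` in the smoothing ball, with `ρ' ≤ μ σ ⊗ ρ'_E`, and
take its marginal `ρ'_E` as the required state. The target error splits into `τ(ρ) - τ(ρ')` and
`τ(ρ') - σ ⊗ ⋯ ⊗ σ ⊗ ρ'_E`, whose trace norms are at most `2(√ε - η)` and `2η`; halving the sum
gives `√ε`.

All trace norms are bounded by domination: if `|⟨x, X x⟩| ≤ ⟨x, P x⟩` for all `x`, then `‖X‖₁ ≤ Tr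
P` (`traceNorm_le_posTrace`). Dominating operators add up, and positive maps carry them along, so
this replaces both the triangle inequality and the contractivity of the trace norm.

The first error is the Fuchs–van de Graaf inequality (`exists_dominating_of_sineDist_le`), pushed
through the convex-split map (`exists_dominating_convexSplit_sub`). The root fidelity is handled
variationally, as the largest trace of an off-diagonal block `Y` that makes the block operator with
diagonal `σ, ρ` positive (`IsCoupling`). This also makes it monotone under partial traces, so that
`ρ'_E` is as close to `ρ_E` as `ρ'` is to `ρ`.

The second error is a variance estimate (`exists_dominating_convexSplit`). With `Ω = √σ ⊗ √ρ'_E`,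
write `ρ' - Ω² = Ω L Ω`. Then the error is `R⁻¹ Ξ (∑ L_r) Ξ`, where `Ξ = √σ ⊗ ⋯ ⊗ √σ ⊗ √ρ'_E` and
`L_r` acts on `A_r E`. As `ρ'` and `σ ⊗ ρ'_E` have the same marginal on `E`, the `√σ`-weighted
partial trace of `L` over `A` vanishes, so distinct `L_r` are uncorrelated and the second moment
`‖(∑ L_r) Ξ‖²` in Hilbert–Schmidt norm is at most `R ‖L Ω‖² ≤ R (μ - 1)` (`hsSq_sumPlace_comp_le`).
Cauchy–Schwarz gives `√((μ - 1) / R)`. The marginal of `ρ'` on `A` plays no role. -/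

set_option linter.unusedSectionVars false

noncomputable section

namespace ConvexSplit

/-! ### Hilbert–Schmidt norm and inner product. -/

section HilbertSchmidt

variable {H K L : Type*} [NormedAddCommGroup H] [InnerProductSpace ℂ H] [CompleteSpace H]
  [NormedAddCommGroup K] [InnerProductSpace ℂ K] [CompleteSpace K]
  [NormedAddCommGroup L] [InnerProductSpace ℂ L] [CompleteSpace L]

theorem tsum_enorm_sq_adjoint {ι κ : Type*} (b : HilbertBasis ι ℂ H) (c : HilbertBasis κ ℂ K)
    (M : H →L[ℂ] K) : ∑' i, ‖M (b i)‖ₑ ^ 2 = ∑' j, ‖M.adjoint (c j)‖ₑ ^ 2 := by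
  calc ∑' i, ‖M (b i)‖ₑ ^ 2 = ∑' i, ∑' j, ‖inner ℂ (c j) (M (b i))‖ₑ ^ 2 :=
        tsum_congr fun i => (tsum_enorm_inner_sq c _).symm
    _ = ∑' j, ∑' i, ‖inner ℂ (c j) (M (b i))‖ₑ ^ 2 := ENNReal.tsum_comm
    _ = ∑' j, ∑' i, ‖inner ℂ (b i) (M.adjoint (c j))‖ₑ ^ 2 := by
        refine tsum_congr fun j => tsum_congr fun i => ?_
        rw [ContinuousLinearMap.adjoint_inner_right, ← ofReal_norm, ← ofReal_norm,
          norm_inner_symm]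
    _ = ∑' j, ‖M.adjoint (c j)‖ₑ ^ 2 := tsum_congr fun j => tsum_enorm_inner_sq b _

/-- The squared Hilbert-Schmidt norm of a bounded operator. -/
def hsSq (M : H →L[ℂ] K) : ℝ≥0∞ := ∑' i, ‖M (stdBasis H i)‖ₑ ^ 2

theorem hsSq_adjoint (M : H →L[ℂ] K) : hsSq M.adjoint = hsSq M :=
  (tsum_enorm_sq_adjoint _ _ M).symm

theorem hsSq_eq {ι : Type*} (b : HilbertBasis ι ℂ H) (M : H →L[ℂ] K) :
    hsSq M = ∑' i, ‖M (b i)‖ₑ ^ 2 := by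
  rw [tsum_enorm_sq_adjoint b (stdBasis K), ← hsSq_adjoint]; rfl

theorem hsSq_comp_le_left (V : K →L[ℂ] L) (hV : ‖V‖ ≤ 1) (M : H →L[ℂ] K) :
    hsSq (V ∘L M) ≤ hsSq M := by
  refine ENNReal.tsum_le_tsum fun i => ?_
  gcongr
  rw [← ofReal_norm, ← ofReal_norm]
  exact ENNReal.ofReal_le_ofReal ((V.le_of_opNorm_le hV _).trans_eq (one_mul _))

theorem hsSq_comp_le_right (M : K →L[ℂ] L) (V : H →L[ℂ] K) (hV : ‖V‖ ≤ 1) :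
    hsSq (M ∘L V) ≤ hsSq M := by
  rw [← hsSq_adjoint, ← hsSq_adjoint M, ContinuousLinearMap.adjoint_comp]
  exact hsSq_comp_le_left _ (by simpa using hV) _

theorem summable_norm_sq {ι : Type*} (b : HilbertBasis ι ℂ H) {M : H →L[ℂ] K}
    (hM : hsSq M ≠ ⊤) : Summable fun i => ‖M (b i)‖ ^ 2 := by
  rw [hsSq_eq b] at hM
  have := ENNReal.summable_toReal hM
  simpa using this

theorem hasSum_norm_sq {ι : Type*} (b : HilbertBasis ι ℂ H) {M : H →L[ℂ] K}
    (hM : hsSq M ≠ ⊤) : HasSum (fun i => ‖M (b i)‖ ^ 2) (hsSq M).toReal := by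
  have h := (summable_norm_sq b hM).hasSum
  rw [hsSq_eq b] at hM ⊢
  rw [ENNReal.tsum_toReal_eq (fun i => ENNReal.ne_top_of_tsum_ne_top hM i)]
  simpa using h

theorem hsSq_comp_ne_top (V : K →L[ℂ] L) {M : H →L[ℂ] K} (hM : hsSq M ≠ ⊤) :
    hsSq (V ∘L M) ≠ ⊤ := by
  have h : hsSq (V ∘L M) ≤ ‖V‖ₑ ^ 2 * hsSq M := by
    unfold hsSq
    rw [← ENNReal.tsum_mul_left]
    refine ENNReal.tsum_le_tsum fun i => ?_
    rw [← mul_pow]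
    gcongr
    exact V.le_opENorm _
  exact ne_top_of_le_ne_top (ENNReal.mul_ne_top (by simp) hM) h

theorem summable_inner_apply {ι : Type*} (b : HilbertBasis ι ℂ H) {M N : H →L[ℂ] K}
    (hM : hsSq M ≠ ⊤) (hN : hsSq N ≠ ⊤) : Summable fun i => inner ℂ (M (b i)) (N (b i)) := by
  refine Summable.of_norm_bounded ((summable_norm_sq b hM).add (summable_norm_sq b hN))
    fun i => (norm_inner_le_norm _ _).trans ?_
  nlinarith [sq_nonneg (‖M (b i)‖ - ‖N (b i)‖), sq_nonneg ‖M (b i)‖, sq_nonneg ‖N (b i)‖]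

theorem norm_tsum_inner_apply_le {ι : Type*} (b : HilbertBasis ι ℂ H) {M N : H →L[ℂ] K}
    (hM : hsSq M ≠ ⊤) (hN : hsSq N ≠ ⊤) :
    ‖∑' i, inner ℂ (M (b i)) (N (b i))‖ ≤ ((hsSq M).toReal + (hsSq N).toReal) / 2 := by
  refine tsum_of_norm_bounded
    (((hasSum_norm_sq b hM).add (hasSum_norm_sq b hN)).div_const 2)
    fun i => (norm_inner_le_norm _ _).trans ?_
  nlinarith [sq_nonneg (‖M (b i)‖ - ‖N (b i)‖)]

/-- The Hilbert-Schmidt inner product is symmetric under taking adjoints and does not depend on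
the orthonormal bases. -/
theorem tsum_inner_apply_eq_adjoint {ι κ : Type*} (b : HilbertBasis ι ℂ H)
    (c : HilbertBasis κ ℂ K) {M N : H →L[ℂ] K} (hM : hsSq M ≠ ⊤) (hN : hsSq N ≠ ⊤) :
    ∑' i, inner ℂ (M (b i)) (N (b i))
      = ∑' j, inner ℂ (N.adjoint (c j)) (M.adjoint (c j)) := by
  have hsq : ∀ T : H →L[ℂ] K, hsSq T ≠ ⊤ →
      Summable fun p : ι × κ => ‖inner ℂ (c p.2) (T (b p.1))‖ ^ 2 := by
    intro T hT
    have : ∑' p : ι × κ, ‖inner ℂ (c p.2) (T (b p.1))‖ₑ ^ 2 ≠ ⊤ := by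
      rw [ENNReal.tsum_prod (f := fun i j => ‖inner ℂ (c j) (T (b i))‖ₑ ^ 2)]
      simp_rw [tsum_enorm_inner_sq]
      rwa [← hsSq_eq]
    simpa using ENNReal.summable_toReal this
  -- Absolute summability over pairs of indices is what permits exchanging the two sums.
  have hsum : Summable fun p : ι × κ =>
      inner ℂ (M (b p.1)) (c p.2) * inner ℂ (c p.2) (N (b p.1)) := by
    refine Summable.of_norm_bounded ((hsq M hM).add (hsq N hN)) fun p => ?_
    rw [norm_mul, norm_inner_symm]
    nlinarith [sq_nonneg (‖inner ℂ (c p.2) (M (b p.1))‖ - ‖inner ℂ (c p.2) (N (b p.1))‖),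
      sq_nonneg ‖inner ℂ (c p.2) (M (b p.1))‖, sq_nonneg ‖inner ℂ (c p.2) (N (b p.1))‖]
  calc ∑' i, inner ℂ (M (b i)) (N (b i))
      = ∑' i, ∑' j, inner ℂ (M (b i)) (c j) * inner ℂ (c j) (N (b i)) :=
        tsum_congr fun i => (c.tsum_inner_mul_inner _ _).symm
    _ = ∑' j, ∑' i, inner ℂ (M (b i)) (c j) * inner ℂ (c j) (N (b i)) :=
        (Summable.tsum_comm (f := fun j i => inner ℂ (M (b i)) (c j) * inner ℂ (c j) (N (b i)))
          hsum.prod_symm)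
    _ = ∑' j, inner ℂ (N.adjoint (c j)) (M.adjoint (c j)) := by
        refine tsum_congr fun j => ?_
        rw [← b.tsum_inner_mul_inner]
        refine tsum_congr fun i => ?_
        rw [ContinuousLinearMap.adjoint_inner_left, ContinuousLinearMap.adjoint_inner_right,
          mul_comm]

end HilbertSchmidt

/-! ### Douglas factorization. -/

section Factorization

variable {H K L : Type*} [NormedAddCommGroup H] [InnerProductSpace ℂ H] [CompleteSpace H]
  [NormedAddCommGroup K] [InnerProductSpace ℂ K] [CompleteSpace K]
  [NormedAddCommGroup L] [InnerProductSpace ℂ L] [CompleteSpace L]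

/-- Douglas factorization. -/
theorem exists_factorization (C : H →L[ℂ] K) (D : H →L[ℂ] L) {c : ℝ} (hc : 0 ≤ c)
    (h : ∀ x, ‖C x‖ ≤ c * ‖D x‖) :
    ∃ V : L →L[ℂ] K, C = V ∘L D ∧ ‖V‖ ≤ c ∧ ∀ y, D.adjoint y = 0 → V y = 0 := by
  set U : Submodule ℂ L := (LinearMap.range D.toLinearMap).topologicalClosure with hU
  have hmem : ∀ x, D x ∈ U := fun x =>
    Submodule.le_topologicalClosure _ (LinearMap.mem_range_self D.toLinearMap x)
  have : CompleteSpace U := (Submodule.isClosed_topologicalClosure _).completeSpace_coe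
  let e : H →ₗ[ℂ] U := D.toLinearMap.codRestrict U hmem
  have hdense : DenseRange e := by
    rintro ⟨y, hy⟩
    rw [Metric.mem_closure_range_iff]
    intro ε hε
    have hy' : y ∈ closure (Set.range D) := hy
    obtain ⟨x, hx⟩ := Metric.mem_closure_range_iff.1 hy' ε hε
    exact ⟨x, hx⟩
  have hn : ∀ x, ‖C.toLinearMap x‖ ≤ c * ‖e x‖ := h
  let W : U →L[ℂ] K := C.toLinearMap.extendOfNorm e
  -- `W` sends `D x` to `C x` on the closure of the range of `D`; the projection extends it by zero
  -- to the orthogonal complement, which is the kernel of `D†`.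
  refine ⟨W ∘L U.orthogonalProjectionOnto, ?_, ?_, ?_⟩
  · ext x
    have h1 : U.orthogonalProjectionOnto (D x) = e x :=
      Submodule.orthogonalProjectionOnto_mem_subspace_eq_self (⟨D x, hmem x⟩ : U)
    change C x = W (U.orthogonalProjectionOnto (D x))
    rw [h1]
    exact (LinearMap.extendOfNorm_eq hdense ⟨c, hn⟩ x).symm
  · refine (ContinuousLinearMap.opNorm_comp_le _ _).trans ?_
    have h1 : ‖W‖ ≤ c := LinearMap.opNorm_extendOfNorm_le hdense hc hn
    have h2 := U.orthogonalProjectionOnto_norm_le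
    nlinarith [norm_nonneg W, norm_nonneg (U.orthogonalProjectionOnto)]
  · intro y hy
    have : y ∈ Uᗮ := by
      rw [hU, Submodule.orthogonal_closure, ContinuousLinearMap.orthogonal_range]
      exact hy
    change W (U.orthogonalProjectionOnto y) = 0
    rw [Submodule.orthogonalProjectionOnto_eq_zero_iff.2 this, map_zero]

end Factorization

/-! ### Positive operators, their traces, and trace norm bounds by domination. -/

section Positive

variable {H K : Type*} [NormedAddCommGroup H] [InnerProductSpace ℂ H] [CompleteSpace H]
  [NormedAddCommGroup K] [InnerProductSpace ℂ K] [CompleteSpace K]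

theorem adjoint_sqrt (T : H →L[ℂ] H) : (CFC.sqrt T).adjoint = CFC.sqrt T :=
  (CFC.sqrt_nonneg T).isSelfAdjoint.adjoint_eq

theorem inner_sqrt_left (T : H →L[ℂ] H) (x y : H) :
    inner ℂ (CFC.sqrt T x) y = inner ℂ x (CFC.sqrt T y) := by
  rw [← ContinuousLinearMap.adjoint_inner_right, adjoint_sqrt]

theorem sqrt_comp_sqrt {T : H →L[ℂ] H} (hT : 0 ≤ T) : CFC.sqrt T ∘L CFC.sqrt T = T :=
  CFC.sqrt_mul_sqrt_self T hT

theorem inner_apply_eq_inner_sqrt {T : H →L[ℂ] H} (hT : 0 ≤ T) (x y : H) :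
    inner ℂ x (T y) = inner ℂ (CFC.sqrt T x) (CFC.sqrt T y) := by
  conv_lhs => rw [← sqrt_comp_sqrt hT]
  rw [inner_sqrt_left]; rfl

theorem re_inner_self_eq (x : H) : (inner ℂ x x).re = ‖x‖ ^ 2 := inner_self_eq_norm_sq (𝕜 := ℂ) x

theorem re_inner_apply_eq {T : H →L[ℂ] H} (hT : 0 ≤ T) (x : H) :
    (inner ℂ x (T x)).re = ‖CFC.sqrt T x‖ ^ 2 := by
  rw [inner_apply_eq_inner_sqrt hT, re_inner_self_eq]

theorem re_inner_symm (x y : H) : (inner ℂ x y).re = (inner ℂ y x).re := inner_re_symm (𝕜 := ℂ) x y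

theorem nonneg_of_re_inner {T : H →L[ℂ] H} (hT : IsSelfAdjoint T)
    (h : ∀ x, 0 ≤ (inner ℂ x (T x)).re) : 0 ≤ T := by
  rw [ContinuousLinearMap.nonneg_iff_isPositive, ContinuousLinearMap.isPositive_def']
  refine ⟨hT, fun x => ?_⟩
  rw [ContinuousLinearMap.reApplyInnerSelf_apply]
  exact (h x).trans_eq (re_inner_symm _ _)

theorem re_inner_nonneg {T : H →L[ℂ] H} (hT : 0 ≤ T) (x : H) : 0 ≤ (inner ℂ x (T x)).re := by
  rw [re_inner_apply_eq hT]; positivity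

theorem ofReal_norm_sq (x : H) : ENNReal.ofReal (‖x‖ ^ 2) = ‖x‖ₑ ^ 2 := by
  rw [ENNReal.ofReal_pow (norm_nonneg _), ofReal_norm]

theorem posTrace_eq_hsSq {T : H →L[ℂ] H} (hT : 0 ≤ T) : posTrace T = hsSq (CFC.sqrt T) := by
  refine tsum_congr fun i => ?_
  rw [re_inner_apply_eq hT, ofReal_norm_sq]

theorem posTrace_adjoint_comp_self (M : H →L[ℂ] K) : posTrace (M.adjoint ∘L M) = hsSq M := by
  refine tsum_congr fun i => ?_
  rw [ContinuousLinearMap.comp_apply, ContinuousLinearMap.adjoint_inner_right, re_inner_self_eq,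
    ofReal_norm_sq]

theorem exists_adjoint_comp_eq {T : H →L[ℂ] H} (hT : 0 ≤ T) :
    ∃ S : H →L[ℂ] H, S.adjoint = S ∧ S ∘L S = T ∧ hsSq S = posTrace T :=
  ⟨CFC.sqrt T, adjoint_sqrt T, sqrt_comp_sqrt hT, (posTrace_eq_hsSq hT).symm⟩

theorem posTrace_add {S T : H →L[ℂ] H} (hS : 0 ≤ S) (hT : 0 ≤ T) :
    posTrace (S + T) = posTrace S + posTrace T := by
  unfold posTrace
  rw [← ENNReal.tsum_add]
  refine tsum_congr fun i => ?_
  rw [add_apply, inner_add_right, Complex.add_re,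
    ENNReal.ofReal_add (re_inner_nonneg hS _) (re_inner_nonneg hT _)]

theorem posTrace_sum {ι : Type*} (s : Finset ι) {T : ι → H →L[ℂ] H} (hT : ∀ i, 0 ≤ T i) :
    posTrace (∑ i ∈ s, T i) = ∑ i ∈ s, posTrace (T i) := by
  classical
  induction s using Finset.induction_on with
  | empty => simp [posTrace]
  | insert a s ha ih =>
    rw [Finset.sum_insert ha, Finset.sum_insert ha,
      posTrace_add (hT a) (Finset.sum_nonneg fun i _ => hT i), ih]

theorem posTrace_smul {c : ℝ} (hc : 0 ≤ c) (T : H →L[ℂ] H) :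
    posTrace ((c : ℂ) • T) = ENNReal.ofReal c * posTrace T := by
  unfold posTrace
  rw [← ENNReal.tsum_mul_left]
  refine tsum_congr fun i => ?_
  rw [smul_apply, inner_smul_right, Complex.re_ofReal_mul,
    ENNReal.ofReal_mul hc]

theorem posTrace_eq_ofReal {ι : Type*} (b : HilbertBasis ι ℂ H) {T : H →L[ℂ] H} (hT : 0 ≤ T)
    {c : ℝ} (h : HasSum (fun i => (inner ℂ (b i) (T (b i))).re) c) :
    posTrace T = ENNReal.ofReal c := by
  rw [posTrace_eq b hT, ← ENNReal.ofReal_tsum_of_nonneg (fun i => re_inner_nonneg hT _)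
    h.summable, h.tsum_eq]

theorem norm_sqrt_apply_sq_le {T : H →L[ℂ] H} (hT : 0 ≤ T) (x : H) :
    ‖CFC.sqrt T x‖ₑ ^ 2 ≤ posTrace T * ‖x‖ₑ ^ 2 := by
  rw [posTrace_eq_hsSq hT, hsSq, ← ENNReal.tsum_mul_right,
    ← tsum_enorm_inner_sq (stdBasis H)]
  refine ENNReal.tsum_le_tsum fun i => ?_
  rw [← mul_pow, ← inner_sqrt_left, ← ofReal_norm, ← ofReal_norm, ← ofReal_norm,
    ← ENNReal.ofReal_mul (norm_nonneg _)]
  gcongr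
  exact norm_inner_le_norm _ _

/-- This is what makes the series of a partial trace converge in operator norm. -/
theorem norm_le_posTrace {T : H →L[ℂ] H} (hT : 0 ≤ T) : ‖T‖ₑ ≤ posTrace T := by
  have h : ‖CFC.sqrt T‖ₑ ^ 2 ≤ posTrace T := by
    by_cases htop : posTrace T = ⊤
    · simp [htop]
    have : ‖CFC.sqrt T‖ ≤ √(posTrace T).toReal := by
      refine ContinuousLinearMap.opNorm_le_bound _ (Real.sqrt_nonneg _) fun x => ?_
      refine abs_le_of_sq_le_sq' ?_ (by positivity) |>.2
      rw [mul_pow, Real.sq_sqrt ENNReal.toReal_nonneg]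
      have := ENNReal.toReal_mono (ENNReal.mul_ne_top htop (by simp)) (norm_sqrt_apply_sq_le hT x)
      simpa using this
    rw [← ofReal_norm, ← ENNReal.ofReal_pow (norm_nonneg _)]
    refine ENNReal.ofReal_le_of_le_toReal ?_
    rw [← Real.sq_sqrt (ENNReal.toReal_nonneg (a := posTrace T))]
    gcongr
  refine le_trans ?_ h
  conv_lhs => rw [← sqrt_comp_sqrt hT]
  rw [sq]
  rw [← ofReal_norm, ← ofReal_norm, ← ENNReal.ofReal_mul (norm_nonneg _)]
  exact ENNReal.ofReal_le_ofReal (ContinuousLinearMap.opNorm_comp_le _ _)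

theorem norm_abs_apply (T : H →L[ℂ] H) (x : H) : ‖CFC.abs T x‖ = ‖T x‖ := by
  have h0 : (CFC.abs T).adjoint = CFC.abs T := (CFC.abs_nonneg T).isSelfAdjoint.adjoint_eq
  have h1 : inner ℂ (CFC.abs T x) (CFC.abs T x) = inner ℂ (T x) (T x) := by
    rw [← ContinuousLinearMap.adjoint_inner_right, ← ContinuousLinearMap.adjoint_inner_right, h0]
    exact congrArg (fun S : H →L[ℂ] H => inner ℂ x (S x)) (CFC.abs_mul_abs T)
  rw [← sq_eq_sq₀ (norm_nonneg _) (norm_nonneg _), ← re_inner_self_eq, ← re_inner_self_eq, h1]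

/-- A weak form of the polar decomposition. -/
theorem exists_abs_eq_comp (T : H →L[ℂ] H) :
    ∃ V : H →L[ℂ] H, CFC.abs T = V ∘L T ∧ ‖V‖ ≤ 1 := by
  obtain ⟨V, h1, h2, -⟩ := exists_factorization (CFC.abs T) T zero_le_one
    (fun x => by rw [one_mul, norm_abs_apply])
  exact ⟨V, h1, h2⟩

theorem exists_eq_comp_abs (T : H →L[ℂ] H) :
    ∃ V : H →L[ℂ] H, T = V ∘L CFC.abs T ∧ ‖V‖ ≤ 1 := by
  obtain ⟨V, h1, h2, -⟩ := exists_factorization T (CFC.abs T) zero_le_one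
    (fun x => by rw [one_mul, norm_abs_apply])
  exact ⟨V, h1, h2⟩

/-- Polarization: `4 Re ⟨x, X y⟩` is the difference of the quadratic form of `X` at `x + y` and at
`x - y`. Bounding both by `P` and applying the parallelogram law to `√P x` and `√P y` gives the
claim. -/
theorem two_mul_re_inner_le_of_abs_le {X P : H →L[ℂ] H} (hX : IsSelfAdjoint X) (hP : 0 ≤ P)
    (h : ∀ x, |(inner ℂ x (X x)).re| ≤ (inner ℂ x (P x)).re) (x y : H) :
    2 * (inner ℂ x (X y)).re ≤ ‖CFC.sqrt P x‖ ^ 2 + ‖CFC.sqrt P y‖ ^ 2 := by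
  have h1 := (abs_le.1 (h (x + y))).2
  have h2 := (abs_le.1 (h (x - y))).1
  have h3 : (inner ℂ y (X x)).re = (inner ℂ x (X y)).re := by
    rw [re_inner_symm, ← ContinuousLinearMap.adjoint_inner_right, hX.adjoint_eq]
  rw [re_inner_apply_eq hP] at h1 h2
  have h4 := parallelogram_law_with_norm ℂ (CFC.sqrt P x) (CFC.sqrt P y)
  simp only [map_add, map_sub, inner_add_left, inner_add_right, inner_sub_left, inner_sub_right,
    Complex.add_re, Complex.sub_re] at h1 h2
  nlinarith

/-- With `|X| = V X` and `‖V‖ ≤ 1`, the diagonal entry `⟨x, |X| x⟩ = ⟨V† x, X x⟩` is at most the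
mean of `‖√P V† x‖²` and `‖√P x‖²`. Summed over a basis, each of the two contributes at most `Tr P`.
-/
theorem traceNorm_le_posTrace {X P : H →L[ℂ] H} (hX : IsSelfAdjoint X) (hP : 0 ≤ P)
    (h : ∀ x, |(inner ℂ x (X x)).re| ≤ (inner ℂ x (P x)).re) : traceNorm X ≤ posTrace P := by
  obtain ⟨V, hV, hV1⟩ := exists_abs_eq_comp X
  have key : ∀ x, ENNReal.ofReal (inner ℂ x (CFC.abs X x)).re
      ≤ 2⁻¹ * (‖(CFC.sqrt P ∘L V.adjoint) x‖ₑ ^ 2 + ‖CFC.sqrt P x‖ₑ ^ 2) := by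
    intro x
    rw [hV, ← ofReal_norm_sq, ← ofReal_norm_sq, ← ENNReal.ofReal_add (by positivity) (by positivity)]
    have e : (2⁻¹ : ℝ≥0∞) = ENNReal.ofReal 2⁻¹ := by
      rw [ENNReal.ofReal_inv_of_pos two_pos]; simp
    rw [e, ← ENNReal.ofReal_mul (by positivity)]
    refine ENNReal.ofReal_le_ofReal ?_
    have := two_mul_re_inner_le_of_abs_le hX hP h (V.adjoint x) x
    rw [ContinuousLinearMap.adjoint_inner_left] at this
    simp only [ContinuousLinearMap.comp_apply]
    linarith
  calc traceNorm X ≤ ∑' i, 2⁻¹ * (‖(CFC.sqrt P ∘L V.adjoint) (stdBasis H i)‖ₑ ^ 2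
        + ‖CFC.sqrt P (stdBasis H i)‖ₑ ^ 2) := ENNReal.tsum_le_tsum fun i => key _
    _ = 2⁻¹ * (hsSq (CFC.sqrt P ∘L V.adjoint) + hsSq (CFC.sqrt P)) := by
        rw [ENNReal.tsum_mul_left, ENNReal.tsum_add]; rfl
    _ ≤ 2⁻¹ * (hsSq (CFC.sqrt P) + hsSq (CFC.sqrt P)) := by
        gcongr
        exact hsSq_comp_le_right _ _ (by simpa using hV1)
    _ = posTrace P := by
        rw [← two_mul, ← mul_assoc, ENNReal.inv_mul_cancel two_ne_zero (by simp), one_mul,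
          posTrace_eq_hsSq hP]

end Positive

/-! ### Variational description of the root fidelity. -/

section Fidelity

variable {H : Type*} [NormedAddCommGroup H] [InnerProductSpace ℂ H] [CompleteSpace H]

theorem IsState.hsSq_sqrt {ρ : H →L[ℂ] H} (hρ : IsState ρ) : hsSq (CFC.sqrt ρ) = 1 := by
  rw [← posTrace_eq_hsSq hρ.1, hρ.2]

theorem IsState.hsSq_sqrt_ne_top {ρ : H →L[ℂ] H} (hρ : IsState ρ) : hsSq (CFC.sqrt ρ) ≠ ⊤ := by
  simp [hρ.hsSq_sqrt]

theorem IsState.hasSum_norm_sq {ι : Type*} (b : HilbertBasis ι ℂ H) {ρ : H →L[ℂ] H}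
    (hρ : IsState ρ) : HasSum (fun i => ‖CFC.sqrt ρ (b i)‖ ^ 2) 1 := by
  simpa [hρ.hsSq_sqrt] using ConvexSplit.hasSum_norm_sq b hρ.hsSq_sqrt_ne_top

theorem IsState.hasSum_re_inner {ι : Type*} (b : HilbertBasis ι ℂ H) {ρ : H →L[ℂ] H}
    (hρ : IsState ρ) : HasSum (fun i => (inner ℂ (b i) (ρ (b i))).re) 1 := by
  simpa only [re_inner_apply_eq hρ.1] using hρ.hasSum_norm_sq b

theorem hsSq_sqrt_abs_ne_top {T : H →L[ℂ] H} (hT : traceNorm T ≠ ⊤) :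
    hsSq (CFC.sqrt (CFC.abs T)) ≠ ⊤ := by
  rwa [← posTrace_eq_hsSq (CFC.abs_nonneg T)]

/-- `⟨x, Y y⟩` is bounded by `‖√σ x‖ ‖√ρ y‖`: the block operator with diagonal `σ, ρ` and off
diagonal `Y` is positive. -/
def IsCoupling (σ ρ Y : H →L[ℂ] H) : Prop :=
  ∀ x y, ‖inner ℂ x (Y y)‖ ≤ ‖CFC.sqrt σ x‖ * ‖CFC.sqrt ρ y‖

/-- `fidelity` passes through `toReal`, which sends `⊤` to `0`, so finiteness has to be secured. It
comes from Cauchy–Schwarz for the Hilbert–Schmidt operators `√ρ V†` and `√σ`. -/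
theorem traceNorm_sqrt_mul_sqrt_le_one {ρ σ : H →L[ℂ] H} (hρ : IsState ρ) (hσ : IsState σ) :
    traceNorm (CFC.sqrt ρ * CFC.sqrt σ) ≤ 1 := by
  obtain ⟨V, hV, hV1⟩ := exists_abs_eq_comp (CFC.sqrt ρ * CFC.sqrt σ)
  have key : ∀ x, ENNReal.ofReal (inner ℂ x (CFC.abs (CFC.sqrt ρ * CFC.sqrt σ) x)).re
      ≤ 2⁻¹ * (‖(CFC.sqrt ρ ∘L V.adjoint) x‖ₑ ^ 2 + ‖CFC.sqrt σ x‖ₑ ^ 2) := by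
    intro x
    rw [hV, ← ofReal_norm_sq, ← ofReal_norm_sq, ← ENNReal.ofReal_add (by positivity) (by positivity)]
    have e : (2⁻¹ : ℝ≥0∞) = ENNReal.ofReal 2⁻¹ := by
      rw [ENNReal.ofReal_inv_of_pos two_pos]; simp
    rw [e, ← ENNReal.ofReal_mul (by positivity)]
    refine ENNReal.ofReal_le_ofReal ?_
    have h1 : inner ℂ x ((V ∘L (CFC.sqrt ρ * CFC.sqrt σ)) x)
        = inner ℂ ((CFC.sqrt ρ ∘L V.adjoint) x) (CFC.sqrt σ x) := by
      simp only [ContinuousLinearMap.comp_apply, inner_sqrt_left,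
        ContinuousLinearMap.adjoint_inner_left]
      rfl
    rw [h1]
    have h2 := (Complex.re_le_norm _).trans
      (norm_inner_le_norm (𝕜 := ℂ) ((CFC.sqrt ρ ∘L V.adjoint) x) (CFC.sqrt σ x))
    nlinarith [sq_nonneg (‖(CFC.sqrt ρ ∘L V.adjoint) x‖ - ‖CFC.sqrt σ x‖)]
  calc traceNorm (CFC.sqrt ρ * CFC.sqrt σ)
      ≤ ∑' i, 2⁻¹ * (‖(CFC.sqrt ρ ∘L V.adjoint) (stdBasis H i)‖ₑ ^ 2
        + ‖CFC.sqrt σ (stdBasis H i)‖ₑ ^ 2) := ENNReal.tsum_le_tsum fun i => key _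
    _ = 2⁻¹ * (hsSq (CFC.sqrt ρ ∘L V.adjoint) + hsSq (CFC.sqrt σ)) := by
        rw [ENNReal.tsum_mul_left, ENNReal.tsum_add]; rfl
    _ ≤ 2⁻¹ * (hsSq (CFC.sqrt ρ) + hsSq (CFC.sqrt σ)) := by
        gcongr
        exact hsSq_comp_le_right _ _ (by simpa using hV1)
    _ = 1 := by
        rw [hρ.hsSq_sqrt, hσ.hsSq_sqrt, one_add_one_eq_two,
          ENNReal.inv_mul_cancel two_ne_zero (by simp)]

theorem traceNorm_sqrt_mul_sqrt_ne_top {ρ σ : H →L[ℂ] H} (hρ : IsState ρ) (hσ : IsState σ) :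
    traceNorm (CFC.sqrt ρ * CFC.sqrt σ) ≠ ⊤ :=
  ne_top_of_le_ne_top ENNReal.one_ne_top (traceNorm_sqrt_mul_sqrt_le_one hρ hσ)

/-- The root fidelity is the trace of a coupling. -/
theorem exists_isCoupling_hasSum {ι : Type*} (b : HilbertBasis ι ℂ H) {ρ σ : H →L[ℂ] H}
    (hρ : IsState ρ) (hσ : IsState σ) :
    ∃ Y : H →L[ℂ] H, IsCoupling σ ρ Y ∧ HasSum (fun i => inner ℂ (b i) (Y (b i)))
      ((traceNorm (CFC.sqrt ρ * CFC.sqrt σ)).toReal : ℂ) := by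
  set T := CFC.sqrt ρ * CFC.sqrt σ with hTdef
  have hT : traceNorm T ≠ ⊤ := traceNorm_sqrt_mul_sqrt_ne_top hρ hσ
  obtain ⟨V, hV, hV1⟩ := exists_abs_eq_comp T
  have hW : hsSq (V ∘L CFC.sqrt ρ) ≠ ⊤ := hsSq_comp_ne_top _ hρ.hsSq_sqrt_ne_top
  -- Cyclicity gives this operator the trace of `V √ρ √σ = |T|`; it is justified by swapping
  -- adjoints in the Hilbert–Schmidt inner product.
  refine ⟨CFC.sqrt σ ∘L V ∘L CFC.sqrt ρ, fun x y => ?_, ?_⟩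
  · rw [ContinuousLinearMap.comp_apply, ← inner_sqrt_left]
    refine (norm_inner_le_norm _ _).trans ?_
    gcongr
    exact (V.le_of_opNorm_le hV1 _).trans_eq (one_mul _)
  · have h1 : ∀ x, inner ℂ x ((CFC.sqrt σ ∘L V ∘L CFC.sqrt ρ) x)
        = inner ℂ (CFC.sqrt σ x) ((V ∘L CFC.sqrt ρ) x) := fun x => by
      rw [ContinuousLinearMap.comp_apply, ← inner_sqrt_left]
    simp only [h1]
    have h2 := (summable_inner_apply b hσ.hsSq_sqrt_ne_top hW).hasSum
    convert h2 using 1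
    have hW' : hsSq (V ∘L CFC.sqrt ρ).adjoint ≠ ⊤ := by rwa [hsSq_adjoint]
    rw [tsum_inner_apply_eq_adjoint b b hσ.hsSq_sqrt_ne_top hW, adjoint_sqrt]
    have h3 : ∀ x, inner ℂ ((V ∘L CFC.sqrt ρ).adjoint x) (CFC.sqrt σ x)
        = ((‖CFC.sqrt (CFC.abs T) x‖ ^ 2 : ℝ) : ℂ) := fun x => by
      rw [ContinuousLinearMap.adjoint_inner_left]
      have : (V ∘L CFC.sqrt ρ) (CFC.sqrt σ x) = CFC.abs T x := by rw [hV]; rfl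
      rw [this, inner_apply_eq_inner_sqrt (CFC.abs_nonneg T), inner_self_eq_norm_sq_to_K]
      simp
    simp only [h3]
    rw [← Complex.ofReal_tsum,
      (ConvexSplit.hasSum_norm_sq b (hsSq_sqrt_abs_ne_top hT)).tsum_eq,
      ← posTrace_eq_hsSq (CFC.abs_nonneg T)]
    rfl

/-- Douglas factorization is used twice: first `√σ` is split off on the left, with a crude constant,
then `√ρ` on the right, now with constant one. -/
theorem IsCoupling.exists_eq_comp {σ ρ Y : H →L[ℂ] H} (hY : IsCoupling σ ρ Y) :
    ∃ W : H →L[ℂ] H, Y = CFC.sqrt σ ∘L W ∘L CFC.sqrt ρ ∧ ‖W‖ ≤ 1 := by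
  have h1 : ∀ x, ‖Y.adjoint x‖ ≤ ‖CFC.sqrt ρ‖ * ‖CFC.sqrt σ x‖ := by
    intro x
    by_cases h0 : ‖Y.adjoint x‖ = 0
    · rw [h0]; positivity
    have h2 := hY x (Y.adjoint x)
    rw [← ContinuousLinearMap.adjoint_inner_left, inner_self_eq_norm_sq_to_K] at h2
    have h3 := (CFC.sqrt ρ).le_opNorm (Y.adjoint x)
    have h4 : ‖Y.adjoint x‖ ^ 2 ≤ ‖CFC.sqrt σ x‖ * (‖CFC.sqrt ρ‖ * ‖Y.adjoint x‖) := by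
      refine le_trans ?_ (h2.trans (by gcongr))
      simp
    have h5 : 0 < ‖Y.adjoint x‖ := lt_of_le_of_ne (norm_nonneg _) (Ne.symm h0)
    nlinarith
  obtain ⟨V, hV, -, hV0⟩ := exists_factorization Y.adjoint (CFC.sqrt σ) (norm_nonneg _) h1
  have hYV : Y = CFC.sqrt σ ∘L V.adjoint := by
    rw [← ContinuousLinearMap.adjoint_adjoint Y, hV, ContinuousLinearMap.adjoint_comp, adjoint_sqrt]
  have h2 : ∀ y, ‖V.adjoint y‖ ≤ 1 * ‖CFC.sqrt ρ y‖ := by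
    intro y
    -- `V` kills the kernel of `√σ`, so the range of `V†` lies in the closure of the range of `√σ`.
    -- The coupling bound extends to that closure by continuity and can then be tested at `u = V†
    -- y`.
    have hmem : V.adjoint y ∈ closure (Set.range (CFC.sqrt σ : H →L[ℂ] H)) := by
      have : V.adjoint y ∈ (LinearMap.range (CFC.sqrt σ).toLinearMap).topologicalClosure := by
        rw [← Submodule.orthogonal_orthogonal_eq_closure, Submodule.mem_orthogonal]
        intro u hu
        rw [ContinuousLinearMap.orthogonal_range] at hu
        rw [ContinuousLinearMap.adjoint_inner_right, hV0 u hu, inner_zero_left]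
      exact this
    have hcl : ∀ u ∈ closure (Set.range (CFC.sqrt σ : H →L[ℂ] H)),
        ‖inner ℂ u (V.adjoint y)‖ ≤ ‖u‖ * ‖CFC.sqrt ρ y‖ := by
      intro u hu
      refine closure_minimal (t := {u | ‖inner ℂ u (V.adjoint y)‖ ≤ ‖u‖ * ‖CFC.sqrt ρ y‖}) ?_
        (isClosed_le (by fun_prop) (by fun_prop)) hu
      rintro _ ⟨x, rfl⟩
      have := hY x y
      rwa [hYV, ContinuousLinearMap.comp_apply, ← inner_sqrt_left] at this
    have h3 := hcl _ hmem
    rw [inner_self_eq_norm_sq_to_K] at h3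
    have h4 : ‖V.adjoint y‖ ^ 2 ≤ ‖V.adjoint y‖ * ‖CFC.sqrt ρ y‖ := by
      refine le_trans ?_ h3; simp
    rw [one_mul]
    by_cases h0 : ‖V.adjoint y‖ = 0
    · rw [h0]; positivity
    have h5 : 0 < ‖V.adjoint y‖ := lt_of_le_of_ne (norm_nonneg _) (Ne.symm h0)
    nlinarith
  obtain ⟨W, hW, hW1, -⟩ := exists_factorization V.adjoint (CFC.sqrt ρ) zero_le_one h2
  exact ⟨W, by rw [← hW, ← hYV], hW1⟩

theorem IsCoupling.summable {ι : Type*} (b : HilbertBasis ι ℂ H) {ρ σ Y : H →L[ℂ] H}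
    (hρ : IsState ρ) (hσ : IsState σ) (hY : IsCoupling σ ρ Y) :
    Summable fun i => inner ℂ (b i) (Y (b i)) := by
  refine Summable.of_norm_bounded ((hσ.hasSum_norm_sq b).summable.add
    (hρ.hasSum_norm_sq b).summable) fun i => (hY _ _).trans ?_
  nlinarith [sq_nonneg (‖CFC.sqrt σ (b i)‖ - ‖CFC.sqrt ρ (b i)‖), sq_nonneg ‖CFC.sqrt σ (b i)‖,
    sq_nonneg ‖CFC.sqrt ρ (b i)‖]

/-- The trace of a coupling is bounded by the root fidelity. -/
theorem IsCoupling.norm_tsum_le {ι : Type*} (b : HilbertBasis ι ℂ H) {ρ σ Y : H →L[ℂ] H}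
    (hρ : IsState ρ) (hσ : IsState σ) (hY : IsCoupling σ ρ Y) :
    ‖∑' i, inner ℂ (b i) (Y (b i))‖ ≤ (traceNorm (CFC.sqrt ρ * CFC.sqrt σ)).toReal := by
  obtain ⟨W, hW, hW1⟩ := hY.exists_eq_comp
  set T := CFC.sqrt ρ * CFC.sqrt σ with hTdef
  have hT : traceNorm T ≠ ⊤ := traceNorm_sqrt_mul_sqrt_ne_top hρ hσ
  obtain ⟨U, hU, hU1⟩ := exists_eq_comp_abs T
  have hWρ : hsSq (W ∘L CFC.sqrt ρ) ≠ ⊤ := hsSq_comp_ne_top _ hρ.hsSq_sqrt_ne_top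
  have h1 : ∀ x, inner ℂ x (Y x) = inner ℂ (CFC.sqrt σ x) ((W ∘L CFC.sqrt ρ) x) := fun x => by
    rw [hW, ContinuousLinearMap.comp_apply, ← inner_sqrt_left]
  simp only [h1]
  rw [tsum_inner_apply_eq_adjoint b b hσ.hsSq_sqrt_ne_top hWρ, adjoint_sqrt]
  set Q := CFC.sqrt (CFC.abs T) with hQ
  have hQtop : hsSq Q ≠ ⊤ := hsSq_sqrt_abs_ne_top hT
  -- The trace of `Y` equals that of `W T = W U |T|`, which is the Hilbert–Schmidt inner product of
  -- `Q Z` and `Q`; both have squared norm at most `Tr |T|`.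
  set Z : H →L[ℂ] H := (W ∘L U).adjoint
  have hZ1 : ‖Z‖ ≤ 1 := by
    rw [LinearIsometryEquiv.norm_map]
    refine (ContinuousLinearMap.opNorm_comp_le _ _).trans ?_
    nlinarith [norm_nonneg W, norm_nonneg U]
  have hQZ : hsSq (Q ∘L Z) ≤ hsSq Q := hsSq_comp_le_right _ _ hZ1
  have h2 : ∀ x, inner ℂ ((W ∘L CFC.sqrt ρ).adjoint x) (CFC.sqrt σ x)
      = inner ℂ ((Q ∘L Z) x) (Q x) := fun x => by
    rw [ContinuousLinearMap.adjoint_inner_left, ContinuousLinearMap.comp_apply (g := Q),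
      ← inner_apply_eq_inner_sqrt (CFC.abs_nonneg T), ContinuousLinearMap.adjoint_inner_left]
    have : W (U (CFC.abs T x)) = W (T x) := by
      conv_rhs => rw [hU]
      rfl
    simp only [ContinuousLinearMap.comp_apply, this]
    rfl
  simp only [h2]
  refine (norm_tsum_inner_apply_le b (ne_top_of_le_ne_top hQtop hQZ) hQtop).trans ?_
  have h3 := ENNReal.toReal_mono hQtop hQZ
  have h4 : (traceNorm T).toReal = (hsSq Q).toReal := by
    rw [hQ, ← posTrace_eq_hsSq (CFC.abs_nonneg T)]; rfl
  rw [h4]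
  linarith

end Fidelity

/-! ### Fuchs–van de Graaf inequality in dominated form. -/

section FuchsVanDeGraaf

variable {H : Type*} [NormedAddCommGroup H] [InnerProductSpace ℂ H] [CompleteSpace H]

/-- The inequality of Fuchs and van de Graaf: if the sine distance of `ρ` and `σ` is at most `d`,
then `ρ - σ` is dominated by a positive operator of trace at most `2 d`. -/
theorem exists_dominating_of_sineDist_le {ρ σ : H →L[ℂ] H} (hρ : IsState ρ) (hσ : IsState σ)
    {d : ℝ} (hd : 0 < d) (h : sineDist ρ σ ≤ d) :
    ∃ P : H →L[ℂ] H, 0 ≤ P ∧ (∀ x, |(inner ℂ x ((ρ - σ) x)).re| ≤ (inner ℂ x (P x)).re) ∧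
      posTrace P ≤ ENNReal.ofReal (2 * d) := by
  obtain ⟨Y, hY, hYf⟩ := exists_isCoupling_hasSum (stdBasis H) hρ hσ
  set f := (traceNorm (CFC.sqrt ρ * CFC.sqrt σ)).toReal with hf
  have hf0 : 0 ≤ f := ENNReal.toReal_nonneg
  have hfd : 1 - f ^ 2 ≤ d ^ 2 := (Real.sqrt_le_left hd.le).1 h
  -- The two parts of `P` below have traces `t (1 - f)` and `t⁻¹ (1 + f)`. This weight makes the
  -- second equal to `d` and the first equal to `(1 - f²) / d ≤ d`, also when `f = 1`.
  set t := (1 + f) / d with ht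
  have ht0 : 0 < t := by positivity
  set Z := Y + Y.adjoint with hZ
  have hZsa : IsSelfAdjoint Z := by
    rw [ContinuousLinearMap.isSelfAdjoint_iff', hZ, map_add, ContinuousLinearMap.adjoint_adjoint,
      add_comm]
  have hZre : ∀ x, (inner ℂ x (Z x)).re = 2 * (inner ℂ x (Y x)).re := fun x => by
    rw [hZ, add_apply, inner_add_right, ContinuousLinearMap.adjoint_inner_right,
      Complex.add_re, re_inner_symm (Y x)]
    ring
  -- The model is `|a² - b²| = |a - b| |a + b| ≤ t/2 (a - b)² + t⁻¹/2 (a + b)²`, with `Z` in the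
  -- role of `2ab`.
  set P : H →L[ℂ] H := ((t / 2 : ℝ) : ℂ) • (ρ + σ - Z) + ((t⁻¹ / 2 : ℝ) : ℂ) • (ρ + σ + Z) with hP
  have hPre : ∀ x, (inner ℂ x (P x)).re = t / 2 * ((inner ℂ x (ρ x)).re + (inner ℂ x (σ x)).re
      - 2 * (inner ℂ x (Y x)).re) + t⁻¹ / 2 * ((inner ℂ x (ρ x)).re + (inner ℂ x (σ x)).re
      + 2 * (inner ℂ x (Y x)).re) := fun x => by
    rw [← hZre, hP]
    simp only [add_apply, sub_apply, smul_apply, inner_add_right, inner_sub_right,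
      inner_smul_right, Complex.add_re, Complex.sub_re, Complex.re_ofReal_mul]
  have hdom : ∀ x, |(inner ℂ x ((ρ - σ) x)).re| ≤ (inner ℂ x (P x)).re := by
    intro x
    have h1 := (Complex.abs_re_le_norm _).trans (hY x x)
    rw [hPre, sub_apply, inner_sub_right, Complex.sub_re, re_inner_apply_eq hρ.1,
      re_inner_apply_eq hσ.1]
    set a := ‖CFC.sqrt ρ x‖
    set b := ‖CFC.sqrt σ x‖
    set y := (inner ℂ x (Y x)).re
    have ha : 0 ≤ a := norm_nonneg _
    have hb : 0 ≤ b := norm_nonneg _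
    have hu : 0 ≤ a ^ 2 + b ^ 2 - 2 * y := by nlinarith [sq_nonneg (a - b), (abs_le.1 h1).2]
    have hv : 0 ≤ a ^ 2 + b ^ 2 + 2 * y := by nlinarith [sq_nonneg (a - b), (abs_le.1 h1).1]
    have hy2 : y ^ 2 ≤ (b * a) ^ 2 := sq_le_sq' (by linarith [(abs_le.1 h1).1]) (abs_le.1 h1).2
    refine abs_le_of_sq_le_sq ?_ (by positivity)
    have e : t * t⁻¹ = 1 := mul_inv_cancel₀ ht0.ne'
    -- By `y² ≤ a² b²`, the last term is at least `(a² + b²)² - 4 a² b² = (a² - b²)²`.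
    have e2 : (t / 2 * (a ^ 2 + b ^ 2 - 2 * y) + t⁻¹ / 2 * (a ^ 2 + b ^ 2 + 2 * y)) ^ 2
        = (t / 2 * (a ^ 2 + b ^ 2 - 2 * y) - t⁻¹ / 2 * (a ^ 2 + b ^ 2 + 2 * y)) ^ 2
        + (t * t⁻¹) * ((a ^ 2 + b ^ 2) ^ 2 - 4 * y ^ 2) := by ring
    rw [e2, e]
    nlinarith [sq_nonneg (t / 2 * (a ^ 2 + b ^ 2 - 2 * y) - t⁻¹ / 2 * (a ^ 2 + b ^ 2 + 2 * y))]
  have hρsa : IsSelfAdjoint ρ := hρ.1.isSelfAdjoint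
  have hσsa : IsSelfAdjoint σ := hσ.1.isSelfAdjoint
  have hPpos : 0 ≤ P := by
    refine nonneg_of_re_inner ?_ fun x => (abs_nonneg _).trans (hdom x)
    exact (IsSelfAdjoint.smul (Complex.conj_ofReal _) ((hρsa.add hσsa).sub hZsa)).add
      (IsSelfAdjoint.smul (Complex.conj_ofReal _) ((hρsa.add hσsa).add hZsa))
  refine ⟨P, hPpos, hdom, ?_⟩
  have h1 := hρ.hasSum_re_inner (stdBasis H)
  have h2 := hσ.hasSum_re_inner (stdBasis H)
  have h3 : HasSum (fun i => (inner ℂ (stdBasis H i) (Y (stdBasis H i))).re) f :=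
    Complex.hasSum_re hYf
  have h4 := (((h1.add h2).sub (h3.mul_left 2)).mul_left (t / 2)).add
    (((h1.add h2).add (h3.mul_left 2)).mul_left (t⁻¹ / 2))
  simp only [← hPre] at h4
  rw [posTrace_eq_ofReal _ hPpos h4]
  refine ENNReal.ofReal_le_ofReal ?_
  have e1 : t / 2 * (1 + 1 - 2 * f) = (1 - f ^ 2) / d := by rw [ht]; field_simp; ring
  have e2 : t⁻¹ / 2 * (1 + 1 + 2 * f) = d := by rw [ht]; field_simp; ring
  rw [e1, e2]
  have : (1 - f ^ 2) / d ≤ d := by rw [div_le_iff₀ hd]; nlinarith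
  linarith

end FuchsVanDeGraaf

/-! ### Partial traces and monotonicity of the fidelity. -/

section PartialTrace

variable {E K : Type*} [NormedAddCommGroup E] [InnerProductSpace ℂ E] [CompleteSpace E]
  [NormedAddCommGroup K] [InnerProductSpace ℂ K] [CompleteSpace K] {ι κ : Type*}

theorem nonneg_adjoint_comp_comp (S : E →L[ℂ] K) {T : K →L[ℂ] K} (hT : 0 ≤ T) :
    0 ≤ S.adjoint ∘L T ∘L S := by
  rw [ContinuousLinearMap.nonneg_iff_isPositive] at hT ⊢
  exact hT.adjoint_conj S

theorem inner_adjoint_comp_comp (S : E →L[ℂ] K) (T : K →L[ℂ] K) (x y : E) :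
    inner ℂ x ((S.adjoint ∘L T ∘L S) y) = inner ℂ (S x) (T (S y)) := by
  rw [ContinuousLinearMap.comp_apply, ContinuousLinearMap.adjoint_inner_right]; rfl

/-- The series `∑ i, S i† T S i`: a partial trace if `S i` is the tensor product with the
`i`-th vector of an orthonormal basis. -/
def partialTrace (S : ι → E →L[ℂ] K) (T : K →L[ℂ] K) : E →L[ℂ] E :=
  ∑' i, (S i).adjoint ∘L T ∘L S i

variable {S : ι → E →L[ℂ] K} {e : HilbertBasis κ ℂ E} {B : HilbertBasis (ι × κ) ℂ K}

/-- The hypothesis `hB` says that the slices `S i` assemble a product basis. Stated this way, the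
theory covers the partial traces over either factor. -/
theorem tsum_posTrace_adjoint_comp_comp (hB : ∀ i k, B (i, k) = S i (e k)) {T : K →L[ℂ] K}
    (hT : 0 ≤ T) : ∑' i, posTrace ((S i).adjoint ∘L T ∘L S i) = posTrace T := by
  rw [posTrace_eq B hT, ENNReal.tsum_prod
    (f := fun i k => ENNReal.ofReal (inner ℂ (B (i, k)) (T (B (i, k)))).re)]
  refine tsum_congr fun i => ?_
  rw [posTrace_eq e (nonneg_adjoint_comp_comp _ hT)]
  refine tsum_congr fun k => ?_
  rw [inner_adjoint_comp_comp, hB]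

theorem summable_adjoint_comp_comp (hB : ∀ i k, B (i, k) = S i (e k)) {T : K →L[ℂ] K}
    (hT : 0 ≤ T) (htop : posTrace T ≠ ⊤) : Summable fun i => (S i).adjoint ∘L T ∘L S i := by
  refine Summable.of_norm ?_
  have h1 : ∑' i, ‖(S i).adjoint ∘L T ∘L S i‖ₑ ≠ ⊤ := by
    refine ne_top_of_le_ne_top htop ?_
    rw [← tsum_posTrace_adjoint_comp_comp hB hT]
    exact ENNReal.tsum_le_tsum fun i => norm_le_posTrace (nonneg_adjoint_comp_comp _ hT)
  simpa using ENNReal.summable_toReal h1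

theorem hasSum_inner_of_summable {T : K →L[ℂ] K}
    (h : Summable fun i => (S i).adjoint ∘L T ∘L S i) (x y : E) :
    HasSum (fun i => inner ℂ (S i x) (T (S i y))) (inner ℂ x (partialTrace S T y)) := by
  have h1 : HasSum _ (partialTrace S T) := h.hasSum
  have h2 := (h1.mapL (ContinuousLinearMap.apply ℂ E y)).mapL (innerSL ℂ x)
  simpa only [ContinuousLinearMap.apply_apply, innerSL_apply_apply, inner_adjoint_comp_comp] using h2

/-- Here `T` is merely bounded and convergence comes from the slices. This serves the partial traces
weighted by a Hilbert–Schmidt operator, applied to a deviation `L` that need not be trace class. -/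
theorem summable_of_summable_norm_sq (h : Summable fun i => ‖S i‖ ^ 2) (T : K →L[ℂ] K) :
    Summable fun i => (S i).adjoint ∘L T ∘L S i := by
  refine Summable.of_norm_bounded (h.mul_right ‖T‖) fun i => ?_
  calc ‖(S i).adjoint ∘L T ∘L S i‖ ≤ ‖(S i).adjoint‖ * (‖T‖ * ‖S i‖) :=
        (ContinuousLinearMap.opNorm_comp_le _ _).trans
          (mul_le_mul_of_nonneg_left (ContinuousLinearMap.opNorm_comp_le _ _) (norm_nonneg _))
    _ = ‖S i‖ ^ 2 * ‖T‖ := by rw [LinearIsometryEquiv.norm_map]; ring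

theorem hasSum_inner_partialTrace (hB : ∀ i k, B (i, k) = S i (e k)) {T : K →L[ℂ] K}
    (hT : 0 ≤ T) (htop : posTrace T ≠ ⊤) (x y : E) :
    HasSum (fun i => inner ℂ (S i x) (T (S i y))) (inner ℂ x (partialTrace S T y)) :=
  hasSum_inner_of_summable (summable_adjoint_comp_comp hB hT htop) x y

theorem partialTrace_nonneg (hB : ∀ i k, B (i, k) = S i (e k)) {T : K →L[ℂ] K}
    (hT : 0 ≤ T) (htop : posTrace T ≠ ⊤) : 0 ≤ partialTrace S T := by
  have h : HasSum _ (partialTrace S T) := (summable_adjoint_comp_comp hB hT htop).hasSum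
  refine nonneg_of_re_inner ?_ fun x => ?_
  · refine HasSum.unique ?_ h
    have h2 := h.star
    simpa only [(nonneg_adjoint_comp_comp (S _) hT).isSelfAdjoint.star_eq] using h2
  · exact (Complex.hasSum_re (hasSum_inner_partialTrace hB hT htop x x)).nonneg
      fun i => re_inner_nonneg hT _

theorem posTrace_partialTrace (hB : ∀ i k, B (i, k) = S i (e k)) {T : K →L[ℂ] K}
    (hT : 0 ≤ T) (htop : posTrace T ≠ ⊤) : posTrace (partialTrace S T) = posTrace T := by
  rw [← tsum_posTrace_adjoint_comp_comp hB hT, posTrace_eq e (partialTrace_nonneg hB hT htop)]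
  have h1 : ∀ i, posTrace ((S i).adjoint ∘L T ∘L S i)
      = ∑' k, ENNReal.ofReal (inner ℂ (S i (e k)) (T (S i (e k)))).re := fun i => by
    rw [posTrace_eq e (nonneg_adjoint_comp_comp _ hT)]
    simp only [inner_adjoint_comp_comp]
  simp only [h1]
  rw [ENNReal.tsum_comm]
  refine tsum_congr fun k => ?_
  have h2 : HasSum _ (inner ℂ (e k) (partialTrace S T (e k))).re :=
    Complex.hasSum_re (hasSum_inner_partialTrace hB hT htop (e k) (e k))
  rw [← h2.tsum_eq, ENNReal.ofReal_tsum_of_nonneg (fun i => re_inner_nonneg hT _) h2.summable]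

theorem IsState.partialTrace (hB : ∀ i k, B (i, k) = S i (e k)) {ρ : K →L[ℂ] K}
    (hρ : IsState ρ) : IsState (partialTrace S ρ) := by
  have htop : posTrace ρ ≠ ⊤ := by simp [hρ.2]
  exact ⟨partialTrace_nonneg hB hρ.1 htop, by rw [posTrace_partialTrace hB hρ.1 htop, hρ.2]⟩

theorem sum_norm_sqrt_sq_le (hB : ∀ i k, B (i, k) = S i (e k)) {ρ : K →L[ℂ] K}
    (hρ : IsState ρ) (F : Finset ι) (x : E) :
    ∑ i ∈ F, ‖CFC.sqrt ρ (S i x)‖ ^ 2 ≤ ‖CFC.sqrt (ConvexSplit.partialTrace S ρ) x‖ ^ 2 := by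
  have htop : posTrace ρ ≠ ⊤ := by simp [hρ.2]
  have h : HasSum _ (inner ℂ x (ConvexSplit.partialTrace S ρ x)).re :=
    Complex.hasSum_re (hasSum_inner_partialTrace hB hρ.1 htop x x)
  rw [re_inner_apply_eq (hρ.partialTrace hB).1] at h
  have h2 : ∀ i, (inner ℂ (S i x) (ρ (S i x))).re = ‖CFC.sqrt ρ (S i x)‖ ^ 2 :=
    fun i => re_inner_apply_eq hρ.1 _
  simp only [h2] at h
  exact sum_le_hasSum F (fun i _ => by positivity) h

/-- Cauchy–Schwarz over `i` turns the bounds on the slices into a bound by the marginals. Finite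
sums suffice, so convergence of the partial trace of `Y` is never needed. -/
theorem IsCoupling.sum (hB : ∀ i k, B (i, k) = S i (e k)) {ρ σ Y : K →L[ℂ] K}
    (hρ : IsState ρ) (hσ : IsState σ) (hY : IsCoupling σ ρ Y) (F : Finset ι) :
    IsCoupling (partialTrace S σ) (partialTrace S ρ) (∑ i ∈ F, (S i).adjoint ∘L Y ∘L S i) := by
  intro x y
  rw [sum_apply, inner_sum]
  simp only [inner_adjoint_comp_comp]
  calc ‖∑ i ∈ F, inner ℂ (S i x) (Y (S i y))‖
      ≤ ∑ i ∈ F, ‖CFC.sqrt σ (S i x)‖ * ‖CFC.sqrt ρ (S i y)‖ :=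
        norm_sum_le_of_le _ fun i _ => hY _ _
    _ ≤ √(∑ i ∈ F, ‖CFC.sqrt σ (S i x)‖ ^ 2) * √(∑ i ∈ F, ‖CFC.sqrt ρ (S i y)‖ ^ 2) :=
        Real.sum_mul_le_sqrt_mul_sqrt _ _ _
    _ ≤ _ := by
        gcongr
        · exact (Real.sqrt_le_sqrt (sum_norm_sqrt_sq_le hB hσ F x)).trans_eq
            (Real.sqrt_sq (norm_nonneg _))
        · exact (Real.sqrt_le_sqrt (sum_norm_sqrt_sq_le hB hρ F y)).trans_eq
            (Real.sqrt_sq (norm_nonneg _))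

/-- The root fidelity does not decrease under a partial trace. -/
theorem traceNorm_sqrt_mul_sqrt_le_partialTrace (hB : ∀ i k, B (i, k) = S i (e k))
    {ρ σ : K →L[ℂ] K} (hρ : IsState ρ) (hσ : IsState σ) :
    (traceNorm (CFC.sqrt ρ * CFC.sqrt σ)).toReal
      ≤ (traceNorm (CFC.sqrt (partialTrace S ρ) * CFC.sqrt (partialTrace S σ))).toReal := by
  obtain ⟨Y, hY, hYf⟩ := exists_isCoupling_hasSum B hρ hσ
  set f := (traceNorm (CFC.sqrt ρ * CFC.sqrt σ)).toReal with hf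
  have h1 : HasSum (fun i => ∑' k, inner ℂ (B (i, k)) (Y (B (i, k)))) (f : ℂ) :=
    hYf.prod_fiberwise fun i => (hYf.summable.prod_factor i).hasSum
  have h2 : ∀ F : Finset ι, ‖∑ i ∈ F, ∑' k, inner ℂ (B (i, k)) (Y (B (i, k)))‖
      ≤ (traceNorm (CFC.sqrt (partialTrace S ρ) * CFC.sqrt (partialTrace S σ))).toReal := by
    intro F
    have h3 := (hY.sum hB hρ hσ F).norm_tsum_le e (hρ.partialTrace hB) (hσ.partialTrace hB)
    refine le_trans (le_of_eq ?_) h3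
    rw [← Summable.tsum_finsetSum fun i _ => hYf.summable.prod_factor i]
    congr 1
    refine tsum_congr fun k => ?_
    rw [sum_apply, inner_sum]
    simp only [inner_adjoint_comp_comp, hB]
  have h3 := le_of_tendsto' h1.norm h2
  rwa [Complex.norm_real, Real.norm_of_nonneg ENNReal.toReal_nonneg] at h3

theorem sineDist_partialTrace_le (hB : ∀ i k, B (i, k) = S i (e k))
    {ρ σ : K →L[ℂ] K} (hρ : IsState ρ) (hσ : IsState σ) :
    sineDist (partialTrace S ρ) (partialTrace S σ) ≤ sineDist ρ σ := by
  refine Real.sqrt_le_sqrt ?_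
  unfold fidelity
  have := traceNorm_sqrt_mul_sqrt_le_partialTrace hB hρ hσ
  gcongr

end PartialTrace

/-! ### Product bases and adjoints on incomplete tensor products. -/

section OrthonormalBases

variable {V W : Type*} [NormedAddCommGroup V] [InnerProductSpace ℂ V]
  [NormedAddCommGroup W] [InnerProductSpace ℂ W] {ι κ : Type*}

/-- An orthonormal family with dense span in an inner product space that need not be complete. -/
structure IsHilbertFamily (f : ι → V) : Prop where
  orthonormal : Orthonormal ℂ f
  dense : (Submodule.span ℂ (Set.range f)).topologicalClosure = ⊤

theorem IsHilbertFamily.of_hilbertBasis [CompleteSpace V] (b : HilbertBasis ι ℂ V) :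
    IsHilbertFamily b := ⟨b.orthonormal, b.dense_span⟩

theorem IsHilbertFamily.comp_equiv {f : ι → V} (hf : IsHilbertFamily f) (e : κ ≃ ι) :
    IsHilbertFamily (f ∘ e) :=
  ⟨hf.orthonormal.comp e e.injective, by rw [e.surjective.range_comp]; exact hf.dense⟩

theorem topologicalClosure_span_tmul_eq_top {f : ι → V} {g : κ → W}
    (hf : (Submodule.span ℂ (Set.range f)).topologicalClosure = ⊤)
    (hg : (Submodule.span ℂ (Set.range g)).topologicalClosure = ⊤) :
    (Submodule.span ℂ (Set.range fun p : ι × κ => f p.1 ⊗ₜ[ℂ] g p.2)).topologicalClosure = ⊤ := by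
  set U := (Submodule.span ℂ (Set.range fun p : ι × κ => f p.1 ⊗ₜ[ℂ] g p.2)).topologicalClosure
    with hU
  have hUc : IsClosed (U : Set (V ⊗[ℂ] W)) := Submodule.isClosed_topologicalClosure _
  have h1 : ∀ i w, f i ⊗ₜ[ℂ] w ∈ U := by
    intro i w
    have : (Submodule.span ℂ (Set.range g)).topologicalClosure
        ≤ U.comap (TensorProduct.mkL ℂ V W (f i)).toLinearMap := by
      refine Submodule.topologicalClosure_minimal _ (Submodule.span_le.2 ?_)
        (hUc.preimage (TensorProduct.mkL ℂ V W (f i)).continuous)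
      rintro _ ⟨k, rfl⟩
      exact Submodule.le_topologicalClosure _ (Submodule.subset_span ⟨(i, k), rfl⟩)
    rw [hg] at this
    exact this (Submodule.mem_top (x := w))
  have h2 : ∀ v w, v ⊗ₜ[ℂ] w ∈ U := by
    intro v w
    have : (Submodule.span ℂ (Set.range f)).topologicalClosure
        ≤ U.comap ((TensorProduct.mkL ℂ V W).flip w).toLinearMap := by
      refine Submodule.topologicalClosure_minimal _ (Submodule.span_le.2 ?_)
        (hUc.preimage ((TensorProduct.mkL ℂ V W).flip w).continuous)
      rintro _ ⟨i, rfl⟩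
      exact h1 i w
    rw [hf] at this
    exact this (Submodule.mem_top (x := v))
  rw [eq_top_iff]
  intro z _
  induction z using TensorProduct.induction_on with
  | zero => exact U.zero_mem
  | tmul v w => exact h2 v w
  | add x y hx hy => exact U.add_mem (hx trivial) (hy trivial)

theorem IsHilbertFamily.tmul {f : ι → V} {g : κ → W} (hf : IsHilbertFamily f)
    (hg : IsHilbertFamily g) : IsHilbertFamily fun p : ι × κ => f p.1 ⊗ₜ[ℂ] g p.2 :=
  ⟨hf.orthonormal.tmul hg.orthonormal, topologicalClosure_span_tmul_eq_top hf.dense hg.dense⟩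

theorem topologicalClosure_span_coe_eq_top {f : ι → V}
    (hf : (Submodule.span ℂ (Set.range f)).topologicalClosure = ⊤) :
    (Submodule.span ℂ (Set.range fun i => (f i : Completion V))).topologicalClosure = ⊤ := by
  set U := (Submodule.span ℂ (Set.range fun i => (f i : Completion V))).topologicalClosure
  have hUc : IsClosed (U : Set (Completion V)) := Submodule.isClosed_topologicalClosure _
  have h1 : ∀ v : V, (v : Completion V) ∈ U := by
    intro v
    have : (Submodule.span ℂ (Set.range f)).topologicalClosure
        ≤ U.comap (Completion.toComplL (𝕜 := ℂ) (E := V)).toLinearMap := by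
      refine Submodule.topologicalClosure_minimal _ (Submodule.span_le.2 ?_)
        (hUc.preimage (Completion.continuous_coe V))
      rintro _ ⟨k, rfl⟩
      exact Submodule.le_topologicalClosure _ (Submodule.subset_span ⟨k, rfl⟩)
    rw [hf] at this
    exact this (Submodule.mem_top (x := v))
  rw [eq_top_iff]
  intro z _
  exact Completion.induction_on z hUc h1

/-- The Hilbert basis of the completion given by an orthonormal family with dense span. -/
def IsHilbertFamily.basis {f : ι → V} (hf : IsHilbertFamily f) :
    HilbertBasis ι ℂ (Completion V) :=
  HilbertBasis.mk (v := fun i => (f i : Completion V))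
    (by
      have h := hf.orthonormal
      constructor
      · intro i; rw [Completion.norm_coe]; exact h.1 i
      · intro i j hij; rw [Completion.inner_coe]; exact h.2 hij)
    (topologicalClosure_span_coe_eq_top hf.dense).ge

@[simp]
theorem IsHilbertFamily.basis_apply {f : ι → V} (hf : IsHilbertFamily f) (i : ι) :
    hf.basis i = (f i : Completion V) :=
  congrFun (HilbertBasis.coe_mk _ _) i

theorem eq_zero_of_inner_eq_zero {f : ι → V} (hf : IsHilbertFamily f)
    {Z : Completion V →L[ℂ] Completion V}
    (h : ∀ i j, inner ℂ (f i : Completion V) (Z (f j)) = 0) : Z = 0 := by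
  refine ContinuousLinearMap.ext_on (s := Set.range hf.basis) ?_ ?_
  · rw [dense_iff_closure_eq]
    have := hf.basis.dense_span
    rw [← Submodule.topologicalClosure_coe, this, Submodule.top_coe]
  · rintro _ ⟨j, rfl⟩
    refine hf.basis.repr.injective ?_
    ext i
    rw [HilbertBasis.repr_apply_apply, hf.basis_apply, hf.basis_apply, h]
    simp

theorem ext_of_apply_coe {f : ι → V}
    (hf : (Submodule.span ℂ (Set.range f)).topologicalClosure = ⊤)
    {Y Z : Completion V →L[ℂ] W}
    (h : ∀ j, Y (f j) = Z (f j)) : Y = Z := by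
  refine ContinuousLinearMap.ext_on (s := Set.range fun i => (f i : Completion V)) ?_ ?_
  · rw [dense_iff_closure_eq, ← Submodule.topologicalClosure_coe,
      topologicalClosure_span_coe_eq_top hf, Submodule.top_coe]
  · rintro _ ⟨j, rfl⟩
    exact h j

theorem completion_comp {X : Type*} [NormedAddCommGroup X] [InnerProductSpace ℂ X]
    (S : W →L[ℂ] X) (T : V →L[ℂ] W) : (S ∘L T).completion = S.completion ∘L T.completion := by
  ext x
  induction x using Completion.induction_on with
  | hp => exact isClosed_eq (by fun_prop) (by fun_prop)
  | ih x => simp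

theorem adjoint_completion {T T' : V →L[ℂ] V} (h : ∀ x y, inner ℂ (T x) y = inner ℂ x (T' y)) :
    T.completion.adjoint = T'.completion := by
  symm
  rw [ContinuousLinearMap.eq_adjoint_iff]
  intro x y
  induction x, y using Completion.induction_on₂ with
  | hp => exact isClosed_eq (by fun_prop) (by fun_prop)
  | ih x y =>
    rw [ContinuousLinearMap.completion_apply_coe, ContinuousLinearMap.completion_apply_coe,
      Completion.inner_coe, Completion.inner_coe, ← inner_conj_symm, ← h, inner_conj_symm]

/-- The adjoints are passed as data because the algebraic tensor factors need not be complete. -/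
theorem inner_mapL_left {S S' : V →L[ℂ] V} {T T' : W →L[ℂ] W}
    (hS : ∀ x y, inner ℂ (S x) y = inner ℂ x (S' y))
    (hT : ∀ x y, inner ℂ (T x) y = inner ℂ x (T' y)) (x y : V ⊗[ℂ] W) :
    inner ℂ (TensorProduct.mapL S T x) y = inner ℂ x (TensorProduct.mapL S' T' y) := by
  induction x using TensorProduct.induction_on with
  | zero => simp
  | add a b ha hb => rw [map_add, inner_add_left, inner_add_left, ha, hb]
  | tmul v w =>
    induction y using TensorProduct.induction_on with
    | zero => simp
    | add a b ha hb => rw [map_add, inner_add_right, inner_add_right, ha, hb]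
    | tmul v' w' =>
      rw [TensorProduct.mapL_tmul, TensorProduct.mapL_tmul, TensorProduct.inner_tmul,
        TensorProduct.inner_tmul, hS, hT]

end OrthonormalBases

/-! ### Two-party tensor products. -/

section Bipartite

variable {A E : Type*} [NormedAddCommGroup A] [InnerProductSpace ℂ A] [CompleteSpace A]
  [NormedAddCommGroup E] [InnerProductSpace ℂ E] [CompleteSpace E]

variable (A E) in
/-- The product basis of the tensor product. -/
def leftBasis : HilbertBasis (basisIndex A × basisIndex E) ℂ (HTensor A E) :=
  ((IsHilbertFamily.of_hilbertBasis (stdBasis A)).tmul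
    (IsHilbertFamily.of_hilbertBasis (stdBasis E))).basis

variable (A E) in
/-- The product basis of the tensor product, indexed in the opposite order. -/
def rightBasis : HilbertBasis (basisIndex E × basisIndex A) ℂ (HTensor A E) :=
  (((IsHilbertFamily.of_hilbertBasis (stdBasis A)).tmul
    (IsHilbertFamily.of_hilbertBasis (stdBasis E))).comp_equiv (Equiv.prodComm _ _)).basis

theorem leftBasis_apply (i : basisIndex A) (k : basisIndex E) :
    leftBasis A E (i, k) = sliceLeft (stdBasis A i) (stdBasis E k) :=
  IsHilbertFamily.basis_apply _ _

theorem rightBasis_apply (k : basisIndex E) (i : basisIndex A) :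
    rightBasis A E (k, i) = sliceRight (stdBasis E k) (stdBasis A i) :=
  IsHilbertFamily.basis_apply _ _

theorem IsState.traceOutLeft {ρ : HTensor A E →L[ℂ] HTensor A E} (hρ : IsState ρ) :
    IsState (traceOutLeft ρ) := hρ.partialTrace leftBasis_apply

theorem IsState.traceOutRight {ρ : HTensor A E →L[ℂ] HTensor A E} (hρ : IsState ρ) :
    IsState (traceOutRight ρ) := hρ.partialTrace rightBasis_apply

theorem sineDist_traceOutLeft_le {ρ σ : HTensor A E →L[ℂ] HTensor A E} (hρ : IsState ρ)
    (hσ : IsState σ) : sineDist (traceOutLeft ρ) (traceOutLeft σ) ≤ sineDist ρ σ :=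
  sineDist_partialTrace_le leftBasis_apply hρ hσ

theorem sliceLeft_apply (a : A) (x : E) : sliceLeft a x = ((a ⊗ₜ[ℂ] x : A ⊗[ℂ] E) : HTensor A E) :=
  rfl

theorem opTensor_coe_tmul (S : A →L[ℂ] A) (T : E →L[ℂ] E) (a : A) (x : E) :
    opTensor S T ((a ⊗ₜ[ℂ] x : A ⊗[ℂ] E) : HTensor A E)
      = ((S a ⊗ₜ[ℂ] T x : A ⊗[ℂ] E) : HTensor A E) := by
  rw [opTensor, ContinuousLinearMap.completion_apply_coe, TensorProduct.mapL_tmul]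

theorem opTensor_comp (S S' : A →L[ℂ] A) (T T' : E →L[ℂ] E) :
    opTensor (S ∘L S') (T ∘L T') = opTensor S T ∘L opTensor S' T' := by
  rw [opTensor, TensorProduct.mapL_comp, completion_comp]; rfl

theorem adjoint_opTensor (S : A →L[ℂ] A) (T : E →L[ℂ] E) :
    (opTensor S T).adjoint = opTensor S.adjoint T.adjoint :=
  adjoint_completion (inner_mapL_left
    (fun x y => (ContinuousLinearMap.adjoint_inner_right S x y).symm)
    (fun x y => (ContinuousLinearMap.adjoint_inner_right T x y).symm))

theorem hsSq_opTensor (S : A →L[ℂ] A) (T : E →L[ℂ] E) :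
    hsSq (opTensor S T) = hsSq S * hsSq T := by
  rw [hsSq_eq (leftBasis A E), ENNReal.tsum_prod
    (f := fun i k => ‖opTensor S T (leftBasis A E (i, k))‖ₑ ^ 2), hsSq, hsSq,
    ← ENNReal.tsum_mul_right]
  refine tsum_congr fun i => ?_
  rw [← ENNReal.tsum_mul_left]
  refine tsum_congr fun k => ?_
  rw [leftBasis_apply, sliceLeft_apply, opTensor_coe_tmul, ← mul_pow]
  congr 1
  rw [← ofReal_norm, Completion.norm_coe, ofReal_norm, TensorProduct.enorm_tmul]

end Bipartite

/-! ### Elementary tensors in `A ⊗ ⋯ ⊗ A ⊗ E`. -/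

section ElementaryTensors

variable {A E : Type u} [NormedAddCommGroup A] [InnerProductSpace ℂ A]
  [NormedAddCommGroup E] [InnerProductSpace ℂ E]

theorem inner_algTmul (e e' : E) : ∀ (n : ℕ) (a a' : Fin n → A),
    inner ℂ (algTmul e n a) (algTmul e' n a') = (∏ i, inner ℂ (a i) (a' i)) * inner ℂ e e'
  | 0, a, a' => by simp; rfl
  | n + 1, a, a' => by
    have ih := inner_algTmul e e' n (Fin.tail a) (Fin.tail a')
    rw [Fin.prod_univ_succ, mul_assoc]
    refine (TensorProduct.inner_tmul (𝕜 := ℂ) (a 0) (a' 0) _ _).trans ?_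
    rw [ih]; rfl

/-- The index type of a product basis. -/
def PowIndex (ι κ : Type u) : ℕ → Type u
  | 0 => κ
  | n + 1 => ι × PowIndex ι κ n

/-- Prepend an index. -/
def PowIndex.cons {ι κ : Type u} {n : ℕ} (i : ι) (p : PowIndex ι κ n) : PowIndex ι κ (n + 1) := (i, p)

/-- The family of elementary tensors of members of two given families. -/
def powFamily {ι κ : Type u} (a : ι → A) (f : κ → E) :
    (n : ℕ) → PowIndex ι κ n → (algPow A E n).carrier
  | 0, k => f k
  | n + 1, p => a p.1 ⊗ₜ[ℂ] powFamily a f n p.2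

theorem exists_powFamily_eq {ι κ : Type u} (a : ι → A) (f : κ → E) : ∀ (n : ℕ) (p : PowIndex ι κ n),
    ∃ k, ∃ i : Fin n → ι, powFamily a f n p = algTmul (f k) n (a ∘ i)
  | 0, p => ⟨p, Fin.elim0, rfl⟩
  | n + 1, p => by
    obtain ⟨k, i, h⟩ := exists_powFamily_eq a f n p.2
    refine ⟨k, Fin.cons p.1 i, ?_⟩
    change a p.1 ⊗ₜ[ℂ] powFamily a f n p.2 = a p.1 ⊗ₜ[ℂ] algTmul (f k) n (a ∘ i)
    rw [h]

theorem IsHilbertFamily.powFamily {ι κ : Type u} {a : ι → A} {f : κ → E} (ha : IsHilbertFamily a)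
    (hf : IsHilbertFamily f) : ∀ n, IsHilbertFamily (powFamily a f n)
  | 0 => hf
  | n + 1 => ha.tmul (IsHilbertFamily.powFamily ha hf n)

/-- The last factor is tested on a chosen family only: when it is itself a completed tensor product,
`placeEquiv` is explicit on product vectors but not on general ones. -/
theorem ext_of_apply_algTmul {X : Type*} [NormedAddCommGroup X] [InnerProductSpace ℂ X]
    [CompleteSpace A] {κ : Type u} {f : κ → E} (hf : IsHilbertFamily f) {n : ℕ}
    {Y Z : HPow A E n →L[ℂ] X}
    (h : ∀ k a, Y (algTmul (f k) n a : (algPow A E n).carrier)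
      = Z (algTmul (f k) n a : (algPow A E n).carrier)) : Y = Z := by
  refine ext_of_apply_coe
    ((IsHilbertFamily.of_hilbertBasis (stdBasis A)).powFamily hf n).dense fun p => ?_
  obtain ⟨k, i, hp⟩ := exists_powFamily_eq (stdBasis A) f n p
  rw [hp]
  exact h _ _

theorem algPowMap_algTmul (σ : A →L[ℂ] A) (T : E →L[ℂ] E) (e : E) : ∀ (n : ℕ) (a : Fin n → A),
    algPowMap σ T n (algTmul e n a) = algTmul (T e) n (σ ∘ a)
  | 0, _ => rfl
  | n + 1, a => by
    change TensorProduct.mapL σ (algPowMap σ T n) (a 0 ⊗ₜ[ℂ] algTmul e n (Fin.tail a)) = _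
    rw [TensorProduct.mapL_tmul, algPowMap_algTmul σ T e n]; rfl

theorem tensorPowOp_coe (σ : A →L[ℂ] A) (T : E →L[ℂ] E) (n : ℕ) (v : (algPow A E n).carrier) :
    tensorPowOp n σ T (v : HPow A E n) = (algPowMap σ T n v : HPow A E n) :=
  ContinuousLinearMap.completion_apply_coe _ _

theorem algPowMap_comp (σ σ' : A →L[ℂ] A) (T T' : E →L[ℂ] E) : ∀ n : ℕ,
    algPowMap (σ ∘L σ') (T ∘L T') n = algPowMap σ T n ∘L algPowMap σ' T' n
  | 0 => rfl
  | n + 1 => by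
    change TensorProduct.mapL (σ ∘L σ') (algPowMap (σ ∘L σ') (T ∘L T') n) = _
    rw [algPowMap_comp σ σ' T T' n, TensorProduct.mapL_comp]; rfl

theorem tensorPowOp_comp (n : ℕ) (σ σ' : A →L[ℂ] A) (T T' : E →L[ℂ] E) :
    tensorPowOp n (σ ∘L σ') (T ∘L T') = tensorPowOp n σ T ∘L tensorPowOp n σ' T' := by
  rw [tensorPowOp, algPowMap_comp, completion_comp]; rfl

theorem algPowMap_sub (σ : A →L[ℂ] A) (T T' : E →L[ℂ] E) : ∀ n : ℕ,
    algPowMap σ (T - T') n = algPowMap σ T n - algPowMap σ T' n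
  | 0 => rfl
  | n + 1 => by
    change TensorProduct.mapL σ (algPowMap σ (T - T') n) = _
    have h := TensorProduct.mapL_add_right σ (algPowMap σ T n - algPowMap σ T' n)
      (algPowMap σ T' n)
    rw [sub_add_cancel] at h
    rw [algPowMap_sub σ T T' n]
    exact eq_sub_of_add_eq h.symm

theorem tensorPowOp_sub (n : ℕ) (σ : A →L[ℂ] A) (T T' : E →L[ℂ] E) :
    tensorPowOp n σ (T - T') = tensorPowOp n σ T - tensorPowOp n σ T' := by
  ext x
  induction x using Completion.induction_on with
  | hp => exact isClosed_eq (by fun_prop) (by fun_prop)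
  | ih x =>
    rw [sub_apply, tensorPowOp_coe, tensorPowOp_coe, tensorPowOp_coe, algPowMap_sub,
      sub_apply, Completion.coe_sub]

end ElementaryTensors

/-! ### Operators on tensor powers and their placement at a position. -/

section Powers

variable {A E : Type u} [NormedAddCommGroup A] [InnerProductSpace ℂ A] [CompleteSpace A]
  [NormedAddCommGroup E] [InnerProductSpace ℂ E] [CompleteSpace E]

theorem inner_algPowMap_left (σ : A →L[ℂ] A) (T : E →L[ℂ] E) : ∀ (n : ℕ)
    (x y : (algPow A E n).carrier),
    inner ℂ (algPowMap σ T n x) y = inner ℂ x (algPowMap σ.adjoint T.adjoint n y)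
  | 0, x, y => (ContinuousLinearMap.adjoint_inner_right T x y).symm
  | n + 1, x, y => inner_mapL_left
      (fun x y => (ContinuousLinearMap.adjoint_inner_right σ x y).symm)
      (inner_algPowMap_left σ T n) x y

theorem adjoint_tensorPowOp (n : ℕ) (σ : A →L[ℂ] A) (T : E →L[ℂ] E) :
    (tensorPowOp n σ T).adjoint = tensorPowOp n σ.adjoint T.adjoint :=
  adjoint_completion (inner_algPowMap_left σ T n)

variable (A E) in
/-- The product basis of `A ⊗ ⋯ ⊗ A ⊗ E`. -/
def powBasis (n : ℕ) :
    HilbertBasis (PowIndex (basisIndex A) (basisIndex E) n) ℂ (HPow A E n) :=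
  ((IsHilbertFamily.of_hilbertBasis (stdBasis A)).powFamily
    (IsHilbertFamily.of_hilbertBasis (stdBasis E)) n).basis

/-- The operator `v ↦ a ⊗ v` on the algebraic tensor product. -/
def consAlg (a : A) (n : ℕ) : (algPow A E n).carrier →L[ℂ] (algPow A E (n + 1)).carrier :=
  TensorProduct.mkL ℂ A (algPow A E n).carrier a

theorem norm_consAlg (a : A) (n : ℕ) (v : (algPow A E n).carrier) :
    ‖consAlg a n v‖ = ‖a‖ * ‖v‖ :=
  TensorProduct.norm_tmul (𝕜 := ℂ) a v

theorem algPowMap_consAlg (n : ℕ) (σ : A →L[ℂ] A) (T : E →L[ℂ] E) (a : A)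
    (v : (algPow A E n).carrier) :
    algPowMap σ T (n + 1) (consAlg a n v) = consAlg (σ a) n (algPowMap σ T n v) :=
  TensorProduct.mapL_tmul σ (algPowMap σ T n) a v

/-- The operator `w ↦ a ⊗ w`. -/
def consL (a : A) (n : ℕ) : HPow A E n →L[ℂ] HPow A E (n + 1) := (consAlg a n).completion

theorem consL_coe (a : A) (n : ℕ) (v : (algPow A E n).carrier) :
    consL a n (v : HPow A E n) = (consAlg a n v : HPow A E (n + 1)) :=
  ContinuousLinearMap.completion_apply_coe _ _

theorem consL_algTmul (a : A) (n : ℕ) (e : E) (v : Fin n → A) :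
    (consL a n (algTmul e n v : (algPow A E n).carrier) : HPow A E (n + 1))
      = (algTmul e (n + 1) (Fin.cons a v : Fin (n + 1) → A) : (algPow A E (n + 1)).carrier) :=
  consL_coe _ _ _

theorem norm_consL (a : A) (n : ℕ) (w : HPow A E n) : ‖consL a n w‖ = ‖a‖ * ‖w‖ := by
  induction w using Completion.induction_on with
  | hp => exact isClosed_eq (by fun_prop) (by fun_prop)
  | ih v => rw [consL_coe, Completion.norm_coe, Completion.norm_coe, norm_consAlg]

theorem enorm_consL (a : A) (n : ℕ) (w : HPow A E n) : ‖consL a n w‖ₑ = ‖a‖ₑ * ‖w‖ₑ := by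
  rw [← ofReal_norm, norm_consL, ENNReal.ofReal_mul (norm_nonneg _), ofReal_norm, ofReal_norm]

theorem opNorm_consL_le (a : A) (n : ℕ) : ‖(consL a n : HPow A E n →L[ℂ] _)‖ ≤ ‖a‖ :=
  ContinuousLinearMap.opNorm_le_bound _ (norm_nonneg _) fun w => (norm_consL a n w).le

theorem powBasis_succ (n : ℕ) (i : basisIndex A) (p : PowIndex (basisIndex A) (basisIndex E) n) :
    powBasis A E (n + 1) (.cons i p) = consL (stdBasis A i) n (powBasis A E n p) := by
  rw [powBasis, powBasis, IsHilbertFamily.basis_apply, IsHilbertFamily.basis_apply, consL_coe]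
  rfl

theorem tensorPowOp_consL (n : ℕ) (σ : A →L[ℂ] A) (T : E →L[ℂ] E) (a : A) (w : HPow A E n) :
    tensorPowOp (n + 1) σ T (consL a n w) = consL (σ a) n (tensorPowOp n σ T w) := by
  induction w using Completion.induction_on with
  | hp => exact isClosed_eq (by fun_prop) (by fun_prop)
  | ih v => rw [consL_coe, tensorPowOp_coe, tensorPowOp_coe, consL_coe, algPowMap_consAlg]

/-- The squared Hilbert-Schmidt norm of an operator that acts on the basis vectors of the first
factor separately. -/
theorem hsSq_eq_mul_of_apply_consL {n : ℕ} {S : A →L[ℂ] A} {N : HPow A E n →L[ℂ] HPow A E n}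
    {M : HPow A E (n + 1) →L[ℂ] HPow A E (n + 1)}
    (h : ∀ i p, M (powBasis A E (n + 1) (.cons i p))
      = consL (S (stdBasis A i)) n (N (powBasis A E n p))) : hsSq M = hsSq S * hsSq N := by
  have h1 : hsSq M = ∑' q : basisIndex A × PowIndex (basisIndex A) (basisIndex E) n,
      ‖M (powBasis A E (n + 1) (.cons q.1 q.2))‖ₑ ^ 2 := hsSq_eq _ _
  rw [h1, ENNReal.tsum_prod (f := fun i p => ‖M (powBasis A E (n + 1) (.cons i p))‖ₑ ^ 2), hsSq,
    hsSq_eq (powBasis A E n), ← ENNReal.tsum_mul_right]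
  refine tsum_congr fun i => ?_
  rw [← ENNReal.tsum_mul_left]
  refine tsum_congr fun p => ?_
  rw [h, enorm_consL, mul_pow]

theorem hsSq_tensorPowOp (σ : A →L[ℂ] A) (T : E →L[ℂ] E) : ∀ n : ℕ,
    hsSq (tensorPowOp n σ T) = hsSq σ ^ n * hsSq T
  | 0 => by
    have h1 := hsSq_eq (powBasis A E 0) (tensorPowOp 0 σ T)
    rw [h1, pow_zero, one_mul, hsSq]
    refine tsum_congr fun k => ?_
    rw [powBasis, IsHilbertFamily.basis_apply, tensorPowOp_coe, ← ofReal_norm,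
      Completion.norm_coe, ← ofReal_norm]
    rfl
  | n + 1 => by
    rw [hsSq_eq_mul_of_apply_consL (S := σ) (N := tensorPowOp n σ T), hsSq_tensorPowOp σ T n,
      pow_succ', mul_assoc]
    intro i p
    rw [powBasis_succ, tensorPowOp_consL]

theorem placeEquiv_symm_algTmul (n : ℕ) (r : Fin (n + 1)) (a : Fin n → A) (b : A) (e : E) :
    (placeEquiv A E n r).symm (algTmul e (n + 1) (Fin.insertNth (α := fun _ => A) r b a) :
        (algPow A E (n + 1)).carrier)
      = (algTmul ((b ⊗ₜ[ℂ] e : A ⊗[ℂ] E) : HTensor A E) n a :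
        (algPow A (HTensor A E) n).carrier) := by
  rw [LinearIsometryEquiv.symm_apply_eq, placeEquiv_algTmul]

theorem placeOp_apply (n : ℕ) (r : Fin (n + 1)) (σ : A →L[ℂ] A)
    (T : HTensor A E →L[ℂ] HTensor A E) (x : HPow A E (n + 1)) :
    placeOp n r σ T x
      = placeEquiv A E n r (tensorPowOp n σ T ((placeEquiv A E n r).symm x)) := rfl

theorem placeOp_algTmul (n : ℕ) (r : Fin (n + 1)) (σ : A →L[ℂ] A)
    (T : HTensor A E →L[ℂ] HTensor A E) (a : Fin n → A) (b : A) (e : E) :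
    placeOp n r σ T (algTmul e (n + 1) (Fin.insertNth (α := fun _ => A) r b a) :
        (algPow A E (n + 1)).carrier)
      = placeEquiv A E n r (algTmul (T ((b ⊗ₜ[ℂ] e : A ⊗[ℂ] E) : HTensor A E)) n (σ ∘ a) :
        (algPow A (HTensor A E) n).carrier) := by
  rw [placeOp_apply, placeEquiv_symm_algTmul, tensorPowOp_coe, algPowMap_algTmul]

theorem placeOp_comp (n : ℕ) (r : Fin (n + 1)) (σ σ' : A →L[ℂ] A)
    (T T' : HTensor A E →L[ℂ] HTensor A E) :
    placeOp n r (σ ∘L σ') (T ∘L T') = placeOp n r σ T ∘L placeOp n r σ' T' := by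
  ext x
  simp only [placeOp_apply, ContinuousLinearMap.comp_apply, tensorPowOp_comp,
    LinearIsometryEquiv.symm_apply_apply]

theorem placeOp_sub (n : ℕ) (r : Fin (n + 1)) (σ : A →L[ℂ] A)
    (T T' : HTensor A E →L[ℂ] HTensor A E) :
    placeOp n r σ (T - T') = placeOp n r σ T - placeOp n r σ T' := by
  ext x
  simp only [placeOp_apply, sub_apply, tensorPowOp_sub, map_sub]

theorem adjoint_placeOp (n : ℕ) (r : Fin (n + 1)) (σ : A →L[ℂ] A)
    (T : HTensor A E →L[ℂ] HTensor A E) :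
    (placeOp n r σ T).adjoint = placeOp n r σ.adjoint T.adjoint := by
  symm
  rw [ContinuousLinearMap.eq_adjoint_iff]
  intro x y
  rw [placeOp_apply, placeOp_apply, LinearIsometryEquiv.inner_map_eq_flip, ← adjoint_tensorPowOp,
    ContinuousLinearMap.adjoint_inner_left, LinearIsometryEquiv.inner_map_eq_flip,
    LinearIsometryEquiv.symm_symm]

/-- A product operator forgets the position `r`, so every term of the convex-split state is compared
with the same reference operator. -/
theorem placeOp_opTensor (n : ℕ) (r : Fin (n + 1)) (σ : A →L[ℂ] A) (T : E →L[ℂ] E) :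
    placeOp n r σ (opTensor σ T) = tensorPowOp (n + 1) σ T := by
  refine ext_of_apply_algTmul (IsHilbertFamily.of_hilbertBasis (stdBasis E)) fun k a => ?_
  have h : σ ∘ a = Fin.insertNth (α := fun _ => A) r (σ (a r)) (σ ∘ r.removeNth a) := by
    rw [Fin.eq_insertNth_iff]; exact ⟨rfl, rfl⟩
  rw [tensorPowOp_coe, algPowMap_algTmul, h, ← placeEquiv_algTmul,
    ← opTensor_coe_tmul, ← placeOp_algTmul, Fin.insertNth_self_removeNth]

theorem hsSq_placeOp_le (n : ℕ) (r : Fin (n + 1)) (σ : A →L[ℂ] A)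
    (T : HTensor A E →L[ℂ] HTensor A E) : hsSq (placeOp n r σ T) ≤ hsSq σ ^ n * hsSq T := by
  rw [← hsSq_tensorPowOp]
  exact (hsSq_comp_le_left _ (LinearIsometry.norm_toContinuousLinearMap_le
    (placeEquiv A E n r).toLinearIsometry) _).trans
    (hsSq_comp_le_right _ _ (LinearIsometry.norm_toContinuousLinearMap_le
      (placeEquiv A E n r).symm.toLinearIsometry))

/-- Placing the square roots of `σ` and `T` gives a square root of the placed operator; positivity
and the trace bound are both read off from it. -/
theorem exists_placeOp_eq_adjoint_comp (n : ℕ) (r : Fin (n + 1)) {σ : A →L[ℂ] A}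
    {T : HTensor A E →L[ℂ] HTensor A E} (hσ : 0 ≤ σ) (hT : 0 ≤ T) :
    ∃ M : HPow A E (n + 1) →L[ℂ] HPow A E (n + 1), placeOp n r σ T = M.adjoint ∘L M ∧
      hsSq M ≤ posTrace σ ^ n * posTrace T := by
  obtain ⟨S, hS, hSσ, hS'⟩ := exists_adjoint_comp_eq hσ
  obtain ⟨Q, hQ, hQT, hQ'⟩ := exists_adjoint_comp_eq hT
  refine ⟨placeOp n r S Q, ?_, ?_⟩
  · rw [adjoint_placeOp, ← placeOp_comp, hS, hQ, hSσ, hQT]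
  · rw [← hS', ← hQ']
    exact hsSq_placeOp_le _ _ _ _

theorem placeOp_nonneg (n : ℕ) (r : Fin (n + 1)) {σ : A →L[ℂ] A}
    {T : HTensor A E →L[ℂ] HTensor A E} (hσ : 0 ≤ σ) (hT : 0 ≤ T) : 0 ≤ placeOp n r σ T := by
  obtain ⟨M, hM, -⟩ := exists_placeOp_eq_adjoint_comp n r hσ hT
  rw [hM, ContinuousLinearMap.nonneg_iff_isPositive]
  exact ContinuousLinearMap.isPositive_adjoint_comp_self _

theorem posTrace_placeOp_le (n : ℕ) (r : Fin (n + 1)) {σ : A →L[ℂ] A}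
    {T : HTensor A E →L[ℂ] HTensor A E} (hσ : IsState σ) (hT : 0 ≤ T) :
    posTrace (placeOp n r σ T) ≤ posTrace T := by
  obtain ⟨M, hM, hM'⟩ := exists_placeOp_eq_adjoint_comp n r hσ.1 hT
  rw [hM, posTrace_adjoint_comp_self]
  rwa [hσ.2, one_pow, one_mul] at hM'

end Powers

/-! ### Second moment of a sum of uncorrelated placed operators. -/

section SumPlace

variable {A E : Type u} [NormedAddCommGroup A] [InnerProductSpace ℂ A] [CompleteSpace A]
  [NormedAddCommGroup E] [InnerProductSpace ℂ E] [CompleteSpace E]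

theorem placeEquiv_consL (n : ℕ) (r : Fin (n + 1)) (a : A) (w : HPow A (HTensor A E) n) :
    placeEquiv A E (n + 1) r.succ (consL a n w) = consL a (n + 1) (placeEquiv A E n r w) := by
  have h : (placeEquiv A E (n + 1) r.succ : HPow A (HTensor A E) (n + 1) →L[ℂ] HPow A E (n + 2))
        ∘L consL a n
      = consL a (n + 1) ∘L (placeEquiv A E n r : HPow A (HTensor A E) n →L[ℂ] HPow A E (n + 1)) := by
    refine ext_of_apply_algTmul (IsHilbertFamily.of_hilbertBasis (leftBasis A E)) fun k v => ?_
    change placeEquiv A E (n + 1) r.succ (consL a n _) = consL a (n + 1) (placeEquiv A E n r _)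
    rw [leftBasis_apply k.1 k.2, sliceLeft_apply, placeEquiv_algTmul, consL_algTmul,
      consL_algTmul, placeEquiv_algTmul]
    congr 2
    exact Fin.insertNth_succ_cons ..
  exact congrArg (fun Z : HPow A (HTensor A E) n →L[ℂ] HPow A E (n + 2) => Z w) h

theorem placeOp_succ_consL (n : ℕ) (r : Fin (n + 1)) (σ : A →L[ℂ] A)
    (T : HTensor A E →L[ℂ] HTensor A E) (a : A) (w : HPow A E (n + 1)) :
    placeOp (n + 1) r.succ σ T (consL a (n + 1) w) = consL (σ a) (n + 1) (placeOp n r σ T w) := by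
  have h : (placeEquiv A E (n + 1) r.succ).symm (consL a (n + 1) w)
      = consL a n ((placeEquiv A E n r).symm w) := by
    rw [LinearIsometryEquiv.symm_apply_eq, placeEquiv_consL, LinearIsometryEquiv.apply_symm_apply]
  rw [placeOp_apply, h, tensorPowOp_consL, placeEquiv_consL, ← placeOp_apply]

/-- The sum over all positions `r` of the operator `L` acting on `E` and the `r`-th copy of `A`. -/
def sumPlace (L : HTensor A E →L[ℂ] HTensor A E) : (n : ℕ) → (HPow A E n →L[ℂ] HPow A E n)
  | 0 => 0
  | n + 1 => ∑ r : Fin (n + 1), placeOp n r 1 L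

/-- Position `0` is split off; the other positions leave the first factor untouched. The induction
for the second moment rests on this. -/
theorem sumPlace_succ_consL (L : HTensor A E →L[ℂ] HTensor A E) : ∀ (n : ℕ) (a : A) (w : HPow A E n),
    sumPlace L (n + 1) (consL a n w)
      = placeOp n 0 1 L (consL a n w) + consL a n (sumPlace L n w)
  | 0, a, w => by
    change (∑ r : Fin 1, placeOp 0 r 1 L) (consL a 0 w) = _ + consL a 0 ((0 : HPow A E 0 →L[ℂ] _) w)
    simp
  | n + 1, a, w => by
    change (∑ r : Fin (n + 2), placeOp (n + 1) r 1 L) (consL a (n + 1) w)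
      = _ + consL a (n + 1) ((∑ r : Fin (n + 1), placeOp n r 1 L) w)
    rw [Fin.sum_univ_succ, add_apply, sum_apply, sum_apply, map_sum]
    simp only [placeOp_succ_consL]
    rfl

theorem cons_eq_insertNth_zero {n : ℕ} (b : A) (a : Fin n → A) :
    (Fin.cons b a : Fin (n + 1) → A) = Fin.insertNth (α := fun _ => A) 0 b a := by
  rw [Fin.insertNth_zero]; rfl

theorem placeOp_zero_consL_algTmul (n : ℕ) (T : HTensor A E →L[ℂ] HTensor A E) (b : A) (e : E)
    (a : Fin n → A) :
    placeOp n 0 1 T (consL b n (algTmul e n a : (algPow A E n).carrier))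
      = placeEquiv A E n 0 (algTmul (T (sliceLeft b e)) n a : (algPow A (HTensor A E) n).carrier) := by
  rw [consL_algTmul, cons_eq_insertNth_zero, placeOp_algTmul]
  rfl

theorem consL_algTmul_eq_placeEquiv (n : ℕ) (b : A) (e : E) (a : Fin n → A) :
    consL b n (algTmul e n a : (algPow A E n).carrier)
      = placeEquiv A E n 0 (algTmul (sliceLeft b e) n a : (algPow A (HTensor A E) n).carrier) := by
  rw [consL_algTmul, cons_eq_insertNth_zero, sliceLeft_apply, placeEquiv_algTmul]

theorem summable_norm_sq_stdBasis {S : A →L[ℂ] A} (hS : hsSq S ≠ ⊤) :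
    Summable fun i => ‖S (stdBasis A i)‖ ^ 2 := summable_norm_sq _ hS

theorem summable_consL {S : A →L[ℂ] A} (hS : hsSq S ≠ ⊤) (n : ℕ) :
    Summable fun i => ‖(consL (S (stdBasis A i)) n : HPow A E n →L[ℂ] _)‖ ^ 2 :=
  Summable.of_nonneg_of_le (fun _ => by positivity)
    (fun _ => by gcongr; exact opNorm_consL_le _ _) (summable_norm_sq_stdBasis hS)

/-- The spectator copies of `A` contribute only inner products independent of the summation index,
so the weighted partial trace over the first copy reduces to that of `L`. -/
theorem partialTrace_placeOp_eq_zero {S : A →L[ℂ] A} (hS : hsSq S ≠ ⊤)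
    {L : HTensor A E →L[ℂ] HTensor A E}
    (hL : ∀ x y : E, HasSum (fun i => inner ℂ (sliceLeft (S (stdBasis A i)) x)
      (L (sliceLeft (S (stdBasis A i)) y))) 0) (n : ℕ) :
    partialTrace (fun i => (consL (S (stdBasis A i)) n : HPow A E n →L[ℂ] _))
      (placeOp n 0 1 L) = 0 := by
  refine eq_zero_of_inner_eq_zero ((IsHilbertFamily.of_hilbertBasis (stdBasis A)).powFamily
    (IsHilbertFamily.of_hilbertBasis (stdBasis E)) n) fun p q => ?_
  obtain ⟨k, i, hp⟩ := exists_powFamily_eq (stdBasis A) (stdBasis E) n p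
  obtain ⟨k', i', hq⟩ := exists_powFamily_eq (stdBasis A) (stdBasis E) n q
  rw [hp, hq]
  refine HasSum.unique (hasSum_inner_of_summable
    (summable_of_summable_norm_sq (summable_consL hS n) _) _ _) ?_
  have h := (hL (stdBasis E k) (stdBasis E k')).mul_left
    (∏ j, inner ℂ (stdBasis A (i j)) (stdBasis A (i' j)))
  rw [mul_zero] at h
  refine h.congr_fun fun j => ?_
  rw [placeOp_zero_consL_algTmul, consL_algTmul_eq_placeEquiv, LinearIsometryEquiv.inner_map_map,
    Completion.inner_coe, inner_algTmul]
  rfl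

theorem hsSq_add_of_tsum_inner_eq_zero {H K : Type*} [NormedAddCommGroup H] [InnerProductSpace ℂ H]
    [CompleteSpace H] [NormedAddCommGroup K] [InnerProductSpace ℂ K] [CompleteSpace K] {ι : Type*}
    (b : HilbertBasis ι ℂ H) {M N : H →L[ℂ] K} (hM : hsSq M ≠ ⊤) (hN : hsSq N ≠ ⊤)
    (h : ∑' i, inner ℂ (M (b i)) (N (b i)) = 0) : hsSq (M + N) = hsSq M + hsSq N := by
  have h0 : HasSum (fun i => (inner ℂ (M (b i)) (N (b i))).re) 0 := by
    have := Complex.hasSum_re (summable_inner_apply b hM hN).hasSum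
    rwa [h] at this
  have h1 := ((hasSum_norm_sq b hM).add (h0.mul_left 2)).add (hasSum_norm_sq b hN)
  have h2 : ∀ i, ‖M (b i)‖ ^ 2 + 2 * (inner ℂ (M (b i)) (N (b i))).re + ‖N (b i)‖ ^ 2
      = ‖(M + N) (b i)‖ ^ 2 := fun i => (norm_add_sq (𝕜 := ℂ) _ _).symm
  simp only [h2] at h1
  rw [mul_zero, add_zero] at h1
  rw [hsSq_eq b]
  have h3 : ∀ i, ‖(M + N) (b i)‖ₑ ^ 2 = ENNReal.ofReal (‖(M + N) (b i)‖ ^ 2) :=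
    fun i => (ofReal_norm_sq _).symm
  simp only [h3]
  rw [← ENNReal.ofReal_tsum_of_nonneg (fun i => by positivity) h1.summable, h1.tsum_eq,
    ENNReal.ofReal_add ENNReal.toReal_nonneg ENNReal.toReal_nonneg, ENNReal.ofReal_toReal hM,
    ENNReal.ofReal_toReal hN]

/-- The second moment of a sum of pairwise uncorrelated operators. -/
theorem hsSq_sumPlace_comp_le {S : A →L[ℂ] A} {Q : E →L[ℂ] E} (hS : hsSq S = 1)
    (hQ : hsSq Q ≠ ⊤) {L : HTensor A E →L[ℂ] HTensor A E}
    (hL : ∀ x y : E, HasSum (fun i => inner ℂ (sliceLeft (S (stdBasis A i)) x)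
      (L (sliceLeft (S (stdBasis A i)) y))) 0) : ∀ n : ℕ,
    hsSq (sumPlace L n ∘L tensorPowOp n S Q) ≤ n * hsSq (L ∘L opTensor S Q)
  | 0 => by
    change hsSq ((0 : HPow A E 0 →L[ℂ] HPow A E 0) ∘L tensorPowOp 0 S Q) ≤ _
    simp [hsSq]
  | n + 1 => by
    have ih := hsSq_sumPlace_comp_le hS hQ hL n
    have hStop : hsSq S ≠ ⊤ := by simp [hS]
    have htop : ∀ m, hsSq (tensorPowOp m S Q) ≠ ⊤ := fun m => by
      rw [hsSq_tensorPowOp, hS, one_pow, one_mul]; exact hQ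
    set M := placeOp n 0 1 L ∘L tensorPowOp (n + 1) S Q with hM
    -- `N` collects the positions other than `0`. On basis vectors it is `S` on the first factor and
    -- the smaller sum on the rest, hence the induction hypothesis applies.
    set N := sumPlace L (n + 1) ∘L tensorPowOp (n + 1) S Q - M with hN
    have hMapp : ∀ i p, M (powBasis A E (n + 1) (.cons i p)) = placeOp n 0 1 L
        (consL (S (stdBasis A i)) n (tensorPowOp n S Q (powBasis A E n p))) := fun i p => by
      rw [hM, ContinuousLinearMap.comp_apply, powBasis_succ, tensorPowOp_consL]
    have hNapp : ∀ i p, N (powBasis A E (n + 1) (.cons i p)) = consL (S (stdBasis A i)) n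
        ((sumPlace L n ∘L tensorPowOp n S Q) (powBasis A E n p)) := fun i p => by
      rw [hN, sub_apply, hMapp, ContinuousLinearMap.comp_apply, powBasis_succ,
        tensorPowOp_consL, sumPlace_succ_consL, add_sub_cancel_left]
      rfl
    have hNsq : hsSq N = hsSq (sumPlace L n ∘L tensorPowOp n S Q) := by
      rw [hsSq_eq_mul_of_apply_consL hNapp, hS, one_mul]
    have hMsq : hsSq M ≤ hsSq (L ∘L opTensor S Q) := by
      have h1 : M = placeOp n 0 S (L ∘L opTensor S Q) := by
        rw [hM, ← placeOp_opTensor n 0, ← placeOp_comp]; rfl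
      rw [h1]
      refine (hsSq_placeOp_le _ _ _ _).trans_eq ?_
      rw [hS, one_pow, one_mul]
    have hMtop : hsSq M ≠ ⊤ := hsSq_comp_ne_top _ (htop _)
    have hNtop : hsSq N ≠ ⊤ := by rw [hNsq]; exact hsSq_comp_ne_top _ (htop _)
    have hcross : ∑' q, inner ℂ (M (powBasis A E (n + 1) q)) (N (powBasis A E (n + 1) q)) = 0 := by
      have hs : Summable fun q : basisIndex A × PowIndex (basisIndex A) (basisIndex E) n =>
          inner ℂ (M (powBasis A E (n + 1) (.cons q.1 q.2)))
            (N (powBasis A E (n + 1) (.cons q.1 q.2))) :=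
        summable_inner_apply (powBasis A E (n + 1)) hMtop hNtop
      change ∑' q : basisIndex A × PowIndex (basisIndex A) (basisIndex E) n,
        inner ℂ (M (powBasis A E (n + 1) (.cons q.1 q.2)))
          (N (powBasis A E (n + 1) (.cons q.1 q.2))) = 0
      -- With the index of the first factor summed innermost, each inner sum is the conjugate of a
      -- matrix element of the weighted partial trace of `L`, which is zero.
      rw [← (Equiv.prodComm _ _).tsum_eq]
      refine (Summable.tsum_prod ((Equiv.prodComm _ _).summable_iff.2 hs)).trans ?_
      refine (tsum_congr fun p => ?_).trans tsum_zero
      have h1 := hasSum_inner_of_summable (summable_of_summable_norm_sq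
        (summable_consL (E := E) hStop n) (placeOp n 0 1 L))
        ((sumPlace L n ∘L tensorPowOp n S Q) (powBasis A E n p))
        (tensorPowOp n S Q (powBasis A E n p))
      rw [partialTrace_placeOp_eq_zero hStop hL] at h1
      have h2 := h1.star
      rw [zero_apply, inner_zero_right, star_zero] at h2
      rw [← h2.tsum_eq]
      refine tsum_congr fun i => ?_
      change inner ℂ (M (powBasis A E (n + 1) (.cons i p))) (N (powBasis A E (n + 1) (.cons i p))) = _
      rw [hMapp, hNapp]
      exact (inner_conj_symm _ _).symm
    have hsum : sumPlace L (n + 1) ∘L tensorPowOp (n + 1) S Q = M + N := by rw [hN]; abel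
    rw [hsum, hsSq_add_of_tsum_inner_eq_zero _ hMtop hNtop hcross, hNsq]
    push_cast
    rw [add_mul, one_mul, add_comm]
    exact add_le_add ih hMsq

end SumPlace

/-! ### The deviation operator and the convex-split estimate. -/

section Decoupling

/-- If `ρ ≤ μ Ω²`, then `ρ - Ω² = Ω L Ω` with a self-adjoint `L` that vanishes on the kernel of `Ω`
and satisfies `(L + 1) (L - (μ - 1)) ≤ 0` on its range. -/
theorem exists_deviation {H : Type*} [NormedAddCommGroup H] [InnerProductSpace ℂ H]
    [CompleteSpace H] {ρ Ω : H →L[ℂ] H} (hρ : 0 ≤ ρ) (hΩ : Ω.adjoint = Ω) {μ : ℝ} (hμ : 0 ≤ μ)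
    (h : ρ ≤ (μ : ℂ) • (Ω ∘L Ω)) :
    ∃ L : H →L[ℂ] H, L.adjoint = L ∧ (∀ x, Ω x = 0 → L x = 0) ∧
      Ω ∘L L ∘L Ω = ρ - Ω ∘L Ω ∧
      ∀ x, ‖L (Ω x)‖ ^ 2 ≤ (μ - 2) * (inner ℂ x (ρ x)).re + ‖Ω x‖ ^ 2 := by
  obtain ⟨R, hR, hRρ, -⟩ := exists_adjoint_comp_eq hρ
  have hRx : ∀ x, (inner ℂ x (ρ x)).re = ‖R x‖ ^ 2 := fun x => by
    rw [← hRρ, ContinuousLinearMap.comp_apply, ← ContinuousLinearMap.adjoint_inner_left, hR,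
      re_inner_self_eq]
  have hle : ∀ x, ‖R x‖ ≤ √μ * ‖Ω x‖ := by
    intro x
    have h1 := re_inner_nonneg (sub_nonneg.2 h) x
    rw [sub_apply, inner_sub_right, Complex.sub_re, hRx, smul_apply, inner_smul_right,
      Complex.re_ofReal_mul, ContinuousLinearMap.comp_apply,
      ← ContinuousLinearMap.adjoint_inner_left, hΩ, re_inner_self_eq] at h1
    refine abs_le_of_sq_le_sq' ?_ (by positivity) |>.2
    rw [mul_pow, Real.sq_sqrt hμ]
    linarith
  obtain ⟨B, hB, hB1, hB0⟩ := exists_factorization R Ω (Real.sqrt_nonneg μ) hle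
  rw [hΩ] at hB0
  -- On the range of `Ω` this is the identity; subtracting it rather than `1` makes `L` vanish on
  -- the kernel of `Ω`.
  set P := (LinearMap.ker Ω.toLinearMap)ᗮ.starProjection with hP
  have hPsa : P.adjoint = P := isSelfAdjoint_starProjection _
  have hPΩ : ∀ x, P (Ω x) = Ω x := fun x => by
    rw [hP, Submodule.starProjection_eq_self_iff, Submodule.mem_orthogonal]
    intro u hu
    have hu' : Ω u = 0 := hu
    rw [← ContinuousLinearMap.adjoint_inner_left, hΩ, hu', inner_zero_left]
  have hP0 : ∀ x, Ω x = 0 → P x = 0 := fun x hx => by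
    rw [hP, Submodule.starProjection_apply_eq_zero_iff]
    exact Submodule.le_orthogonal_orthogonal _ hx
  have hBΩ : ∀ x, B (Ω x) = R x := fun x => by rw [hB]; rfl
  refine ⟨B.adjoint ∘L B - P, ?_, fun x hx => ?_, ?_, fun x => ?_⟩
  · rw [map_sub, ContinuousLinearMap.adjoint_comp, ContinuousLinearMap.adjoint_adjoint, hPsa]
  · rw [sub_apply, ContinuousLinearMap.comp_apply, hB0 x hx, hP0 x hx, map_zero, sub_zero]
  · ext x
    have h1 : Ω (B.adjoint (R x)) = R (R x) := by
      have h2 : R = Ω ∘L B.adjoint := by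
        rw [← hR, hB, ContinuousLinearMap.adjoint_comp, hΩ]
      exact (congrArg (fun Z : H →L[ℂ] H => Z (R x)) h2).symm
    simp only [ContinuousLinearMap.comp_apply, sub_apply, map_sub, hBΩ, hPΩ, h1, ← hRρ]
  -- In the expanded square, `‖B‖² ≤ μ` bounds the first term by `μ ‖R x‖²`, and the cross term is
  -- exactly `-2 ‖R x‖²`.
  · have h1 : (B.adjoint ∘L B - P) (Ω x) = B.adjoint (R x) - Ω x := by
      rw [sub_apply, ContinuousLinearMap.comp_apply, hBΩ, hPΩ]
    have h2 : (inner ℂ (B.adjoint (R x)) (Ω x)).re = ‖R x‖ ^ 2 := by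
      rw [ContinuousLinearMap.adjoint_inner_left, hBΩ, re_inner_self_eq]
    have h3 : ‖B.adjoint (R x)‖ ^ 2 ≤ μ * ‖R x‖ ^ 2 := by
      have h4 : ‖B.adjoint (R x)‖ ≤ √μ * ‖R x‖ :=
        B.adjoint.le_of_opNorm_le (by rwa [LinearIsometryEquiv.norm_map]) _
      calc ‖B.adjoint (R x)‖ ^ 2 ≤ (√μ * ‖R x‖) ^ 2 := by gcongr
        _ = _ := by rw [mul_pow, Real.sq_sqrt hμ]
    have h5 : ‖B.adjoint (R x) - Ω x‖ ^ 2 = ‖B.adjoint (R x)‖ ^ 2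
        - 2 * (inner ℂ (B.adjoint (R x)) (Ω x)).re + ‖Ω x‖ ^ 2 := norm_sub_sq (𝕜 := ℂ) _ _
    rw [h1, h5, h2, hRx]
    linarith

/-- Summing over a basis gives `(μ - 2) · 1 + 1`. Keeping the `-1` leaves room for a non-optimal `μ`
in the final step. -/
theorem hsSq_le_of_norm_sq_le {H : Type*} [NormedAddCommGroup H] [InnerProductSpace ℂ H]
    [CompleteSpace H] {ρ Ω M : H →L[ℂ] H} (hρ : IsState ρ) (hΩ : hsSq Ω = 1) {μ : ℝ}
    (h : ∀ x, ‖M x‖ ^ 2 ≤ (μ - 2) * (inner ℂ x (ρ x)).re + ‖Ω x‖ ^ 2) :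
    hsSq M ≤ ENNReal.ofReal (μ - 1) := by
  have h1 := hasSum_norm_sq (stdBasis H) (M := Ω) (by simp [hΩ])
  rw [hΩ] at h1
  have h2 := ((hρ.hasSum_re_inner (stdBasis H)).mul_left (μ - 2)).add h1
  have h3 : (μ - 2) * 1 + (1 : ℝ≥0∞).toReal = μ - 1 := by rw [ENNReal.toReal_one]; ring
  rw [h3] at h2
  calc hsSq M = ∑' i, ENNReal.ofReal (‖M (stdBasis H i)‖ ^ 2) :=
        tsum_congr fun i => (ofReal_norm_sq _).symm
    _ ≤ ∑' i, ENNReal.ofReal ((μ - 2) * (inner ℂ (stdBasis H i) (ρ (stdBasis H i))).re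
        + ‖Ω (stdBasis H i)‖ ^ 2) :=
        ENNReal.tsum_le_tsum fun i => ENNReal.ofReal_le_ofReal (h _)
    _ = ENNReal.ofReal (μ - 1) := by
        rw [← ENNReal.ofReal_tsum_of_nonneg (fun i => (sq_nonneg _).trans (h _)) h2.summable,
          h2.tsum_eq]

variable {A E : Type u} [NormedAddCommGroup A] [InnerProductSpace ℂ A] [CompleteSpace A]
  [NormedAddCommGroup E] [InnerProductSpace ℂ E] [CompleteSpace E]

theorem norm_sliceLeft_apply (a : A) (x : E) : ‖sliceLeft a x‖ = ‖a‖ * ‖x‖ := by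
  rw [sliceLeft_apply, Completion.norm_coe, TensorProduct.norm_tmul]

theorem summable_sliceLeft {S : A →L[ℂ] A} (hS : hsSq S ≠ ⊤) :
    Summable fun i => ‖(sliceLeft (S (stdBasis A i)) : E →L[ℂ] _)‖ ^ 2 :=
  Summable.of_nonneg_of_le (fun _ => by positivity)
    (fun _ => by
      gcongr
      exact ContinuousLinearMap.opNorm_le_bound _ (norm_nonneg _)
        fun x => (norm_sliceLeft_apply _ x).le) (summable_norm_sq_stdBasis hS)

/-- The deviation of a state from a product state with the same marginal on `E` has a vanishing
partial trace, also without the outer factors on `E`. -/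
theorem partialTrace_deviation_eq_zero {S : A →L[ℂ] A} {Q : E →L[ℂ] E}
    {ρ L : HTensor A E →L[ℂ] HTensor A E} (hρ : IsState ρ) (hS : S.adjoint = S) (hS1 : hsSq S = 1)
    (hQ : Q.adjoint = Q) (hQρ : Q ∘L Q = traceOutLeft ρ) (hL : L.adjoint = L)
    (hL0 : ∀ x, opTensor S Q x = 0 → L x = 0)
    (hLρ : opTensor S Q ∘L L ∘L opTensor S Q = ρ - opTensor S Q ∘L opTensor S Q) :
    partialTrace (fun i => (sliceLeft (S (stdBasis A i)) : E →L[ℂ] HTensor A E)) L = 0 := by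
  set C : basisIndex A → E →L[ℂ] HTensor A E := fun i => sliceLeft (S (stdBasis A i)) with hC
  have hStop : hsSq S ≠ ⊤ := by simp [hS1]
  have hsum : ∀ x y, HasSum (fun i => inner ℂ (C i x) (L (C i y))) (inner ℂ x (partialTrace C L y)) :=
    hasSum_inner_of_summable (summable_of_summable_norm_sq (summable_sliceLeft hStop) L)
  set M := partialTrace C L with hM
  have hΩ : (opTensor S Q).adjoint = opTensor S Q := by rw [adjoint_opTensor, hS, hQ]
  have hΩC : ∀ a x, opTensor S Q (sliceLeft a x) = sliceLeft (S a) (Q x) := fun a x =>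
    opTensor_coe_tmul S Q a x
  have hQsymm : ∀ x y, inner ℂ (Q x) y = inner ℂ x (Q y) := fun x y => by
    rw [← ContinuousLinearMap.adjoint_inner_right, hQ]
  have hMsymm : ∀ x y, inner ℂ (M x) y = inner ℂ x (M y) := by
    intro x y
    have h1 := (hsum y x).star
    have h2 : ∀ i, star (inner ℂ (C i y) (L (C i x))) = inner ℂ (C i x) (L (C i y)) := fun i => by
      rw [← ContinuousLinearMap.adjoint_inner_left L, hL]
      exact inner_conj_symm _ _
    simp only [h2] at h1
    rw [(hsum x y).unique h1]
    exact (inner_conj_symm _ _).symm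
  have hM0 : ∀ y, Q y = 0 → M y = 0 := by
    intro y hy
    refine ext_inner_left ℂ fun x => ?_
    rw [inner_zero_right]
    refine (hsum x y).unique ?_
    have h1 : ∀ i, L (C i y) = 0 := fun i => hL0 _ (by rw [hC, hΩC, hy, map_zero])
    simp only [h1, inner_zero_right]
    exact hasSum_zero
  -- `Q M Q` is the partial trace of `Ω L Ω = ρ - Ω²`, namely `ρ_E - Tr(S²) Q² = 0`.
  have hQMQ : ∀ y, Q (M (Q y)) = 0 := by
    intro y
    refine ext_inner_left ℂ fun x => ?_
    rw [← hQsymm, inner_zero_right]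
    refine (hsum _ _).unique ?_
    have h1 : HasSum (fun i => inner ℂ (sliceLeft (stdBasis A i) x) (ρ (sliceLeft (stdBasis A i) y)))
        (inner ℂ x (traceOutLeft ρ y)) :=
      hasSum_inner_partialTrace leftBasis_apply hρ.1 (by simp [hρ.2]) x y
    have h2 : HasSum (fun i => inner ℂ (C i (Q x)) (C i (Q y))) (inner ℂ x (traceOutLeft ρ y)) := by
      have h3 := (Complex.hasSum_ofReal.2
        (hasSum_norm_sq (stdBasis A) hStop)).mul_right (inner ℂ (Q x) (Q y))
      rw [hS1, ENNReal.toReal_one, Complex.ofReal_one, one_mul, hQsymm] at h3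
      rw [← hQρ]
      refine h3.congr_fun fun i => ?_
      rw [hC, sliceLeft_apply, sliceLeft_apply, Completion.inner_coe, TensorProduct.inner_tmul,
        hQsymm, inner_self_eq_norm_sq_to_K]
      push_cast
      rfl
    have h4 := h1.sub h2
    rw [sub_self] at h4
    refine h4.congr_fun fun i => ?_
    have h5 : ∀ z, C i (Q z) = opTensor S Q (sliceLeft (stdBasis A i) z) := fun z => (hΩC _ _).symm
    have h6 : opTensor S Q (L (opTensor S Q (sliceLeft (stdBasis A i) y)))
        = ρ (sliceLeft (stdBasis A i) y)
          - opTensor S Q (opTensor S Q (sliceLeft (stdBasis A i) y)) :=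
      congrArg (fun Z : HTensor A E →L[ℂ] HTensor A E => Z (sliceLeft (stdBasis A i) y)) hLρ
    have h7 : ∀ u v, inner ℂ (opTensor S Q u) v = inner ℂ u (opTensor S Q v) := fun u v => by
      rw [← ContinuousLinearMap.adjoint_inner_right, hΩ]
    rw [h5, h5, h7, h6, inner_sub_right, h7]
  -- `M Q y` lies in the kernel of `Q`, where `M` vanishes, so symmetry gives `‖M Q y‖² = ⟨Q y, M M
  -- Q y⟩ = 0`. Then `Q M = 0` by symmetry, and the same argument yields `M = 0`.
  have hMQ : ∀ y, M (Q y) = 0 := fun y => by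
    rw [← inner_self_eq_zero (𝕜 := ℂ), hMsymm, hM0 _ (hQMQ y), inner_zero_right]
  have hQM : ∀ y, Q (M y) = 0 := fun y => by
    refine ext_inner_left ℂ fun x => ?_
    rw [← hQsymm, ← hMsymm, hMQ, inner_zero_left, inner_zero_right]
  ext y
  rw [zero_apply, ← inner_self_eq_zero (𝕜 := ℂ), hMsymm, hM0 _ (hQM y), inner_zero_right]

theorem placeOp_deviation (n : ℕ) (r : Fin (n + 1)) {S : A →L[ℂ] A} {Q : E →L[ℂ] E}
    (L : HTensor A E →L[ℂ] HTensor A E) :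
    placeOp n r (S ∘L S) (opTensor S Q ∘L L ∘L opTensor S Q)
      = tensorPowOp (n + 1) S Q ∘L placeOp n r 1 L ∘L tensorPowOp (n + 1) S Q := by
  rw [← placeOp_opTensor n r, ← placeOp_comp, ← placeOp_comp]
  rfl

/-- The convex-split lemma in terms of domination: `τ - ρ_A ⊗ ⋯ ⊗ ρ_A ⊗ ρ_E` is dominated by a
positive operator of trace at most `√((μ - 1) / R)`. -/
theorem exists_dominating_convexSplit {σ : A →L[ℂ] A} {ρ : HTensor A E →L[ℂ] HTensor A E}
    (hσ : IsState σ) (hρ : IsState ρ) {μ : ℝ} (hμ : 0 ≤ μ)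
    (h : ρ ≤ (μ : ℂ) • opTensor σ (traceOutLeft ρ)) (n : ℕ) {t : ℝ} (ht : 0 < t)
    (hμt : (μ - 1) / ((n + 1 : ℕ) : ℝ) ≤ t ^ 2) :
    ∃ P : HPow A E (n + 1) →L[ℂ] HPow A E (n + 1), 0 ≤ P ∧
      (∀ x, |(inner ℂ x ((convexSplit σ ρ (n + 1)
        - tensorPowOp (n + 1) σ (traceOutLeft ρ)) x)).re| ≤ (inner ℂ x (P x)).re) ∧
      posTrace P ≤ ENNReal.ofReal t := by
  obtain ⟨S, hS, hSσ, hS1⟩ := exists_adjoint_comp_eq hσ.1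
  obtain ⟨Q, hQ, hQρ, hQ1⟩ := exists_adjoint_comp_eq hρ.traceOutLeft.1
  rw [hσ.2] at hS1
  rw [hρ.traceOutLeft.2] at hQ1
  set Ω := opTensor S Q with hΩdef
  have hΩ : Ω.adjoint = Ω := by rw [hΩdef, adjoint_opTensor, hS, hQ]
  have hΩ2 : Ω ∘L Ω = opTensor σ (traceOutLeft ρ) := by rw [hΩdef, ← opTensor_comp, hSσ, hQρ]
  have hΩ1 : hsSq Ω = 1 := by rw [hΩdef, hsSq_opTensor, hS1, hQ1, one_mul]
  rw [← hΩ2] at h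
  obtain ⟨L, hL, hL0, hLρ, hLle⟩ := exists_deviation hρ.1 hΩ hμ h
  have hLΩ : hsSq (L ∘L Ω) ≤ ENNReal.ofReal (μ - 1) := hsSq_le_of_norm_sq_le hρ hΩ1 hLle
  have hStop : hsSq S ≠ ⊤ := by simp [hS1]
  have hdev := partialTrace_deviation_eq_zero hρ hS hS1 hQ hQρ hL hL0 hLρ
  have hcorr : ∀ x y : E, HasSum (fun i => inner ℂ (sliceLeft (S (stdBasis A i)) x)
      (L (sliceLeft (S (stdBasis A i)) y))) 0 := fun x y => by
    have h1 := hasSum_inner_of_summable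
      (summable_of_summable_norm_sq (summable_sliceLeft (E := E) hStop) L) x y
    rwa [hdev, zero_apply, inner_zero_right] at h1
  have hG := hsSq_sumPlace_comp_le hS1 (Q := Q) (by simp [hQ1]) hcorr (n + 1)
  set Ξ : HPow A E (n + 1) →L[ℂ] HPow A E (n + 1) := tensorPowOp (n + 1) S Q with hΞdef
  set G := sumPlace L (n + 1) with hGdef
  have hΞ : Ξ.adjoint = Ξ := by rw [hΞdef, adjoint_tensorPowOp, hS, hQ]
  have hΞ1 : hsSq Ξ = 1 := by rw [hΞdef, hsSq_tensorPowOp, hS1, hQ1, one_pow, one_mul]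
  set N : ℝ := ((n + 1 : ℕ) : ℝ) with hN
  have hN0 : 0 < N := by positivity
  have hdiff : convexSplit σ ρ (n + 1) - tensorPowOp (n + 1) σ (traceOutLeft ρ)
      = ((N⁻¹ : ℝ) : ℂ) • (Ξ ∘L G ∘L Ξ) := by
    have h1 : Ξ ∘L G ∘L Ξ = ∑ r : Fin (n + 1), (placeOp n r σ ρ
        - tensorPowOp (n + 1) σ (traceOutLeft ρ)) := by
      have h2 : ∀ r : Fin (n + 1), placeOp n r σ ρ - tensorPowOp (n + 1) σ (traceOutLeft ρ)
          = Ξ ∘L placeOp n r 1 L ∘L Ξ := fun r => by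
        rw [← placeOp_deviation, hLρ, hSσ, placeOp_sub, hΩ2, placeOp_opTensor]
      simp only [h2]
      ext x
      change Ξ ((∑ r : Fin (n + 1), placeOp n r 1 L) (Ξ x)) = _
      rw [sum_apply, sum_apply, map_sum]
      rfl
    rw [h1, Finset.sum_sub_distrib, Finset.sum_const, Finset.card_univ, Fintype.card_fin, smul_sub,
      ← Nat.cast_smul_eq_nsmul ℂ, smul_smul, hN]
    have h3 : (((((n + 1 : ℕ) : ℝ)⁻¹ : ℝ) : ℂ)) * ((n + 1 : ℕ) : ℂ) = 1 := by
      push_cast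
      exact inv_mul_cancel₀ (Nat.cast_add_one_ne_zero n)
    rw [h3, one_smul, convexSplit]
    push_cast
    rw [one_div]
  -- The weighted arithmetic–geometric mean inequality for `N⁻¹ ‖Ξ x‖ ‖G Ξ x‖`. The trace is `t/2 +
  -- ‖G Ξ‖² / (2 t N²)`, and the second moment bound `N² t²` makes it at most `t`.
  set P : HPow A E (n + 1) →L[ℂ] HPow A E (n + 1) :=
    ((t / 2 : ℝ) : ℂ) • (Ξ.adjoint ∘L Ξ)
      + ((t⁻¹ * N⁻¹ ^ 2 / 2 : ℝ) : ℂ) • ((G ∘L Ξ).adjoint ∘L (G ∘L Ξ)) with hP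
  have hsq : ∀ M : HPow A E (n + 1) →L[ℂ] HPow A E (n + 1), 0 ≤ M.adjoint ∘L M := fun M => by
    rw [ContinuousLinearMap.nonneg_iff_isPositive]
    exact ContinuousLinearMap.isPositive_adjoint_comp_self M
  have hsmul : ∀ (c : ℝ) (T : HPow A E (n + 1) →L[ℂ] HPow A E (n + 1)), 0 ≤ c → 0 ≤ T →
      0 ≤ (c : ℂ) • T := fun c T hc hT => by
    rw [ContinuousLinearMap.nonneg_iff_isPositive] at hT ⊢
    exact hT.smul_of_nonneg (by exact_mod_cast hc)
  have h0 := hsmul (t / 2) _ (by positivity) (hsq Ξ)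
  have h1 := hsmul (t⁻¹ * N⁻¹ ^ 2 / 2) _ (by positivity) (hsq (G ∘L Ξ))
  refine ⟨P, add_nonneg h0 h1, fun x => ?_, ?_⟩
  · have h2 : (inner ℂ x (P x)).re = t / 2 * ‖Ξ x‖ ^ 2
        + t⁻¹ * N⁻¹ ^ 2 / 2 * ‖(G ∘L Ξ) x‖ ^ 2 := by
      rw [hP]
      simp only [add_apply, smul_apply, inner_add_right, inner_smul_right, Complex.add_re,
        Complex.re_ofReal_mul]
      rw [ContinuousLinearMap.comp_apply, ContinuousLinearMap.comp_apply (g := (G ∘L Ξ).adjoint),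
        ContinuousLinearMap.adjoint_inner_right, ContinuousLinearMap.adjoint_inner_right,
        re_inner_self_eq, re_inner_self_eq]
    have h3 : (inner ℂ x ((((N⁻¹ : ℝ) : ℂ) • (Ξ ∘L G ∘L Ξ)) x)).re
        = N⁻¹ * (inner ℂ (Ξ x) ((G ∘L Ξ) x)).re := by
      rw [smul_apply, inner_smul_right, Complex.re_ofReal_mul, ContinuousLinearMap.comp_apply,
        ← ContinuousLinearMap.adjoint_inner_left, hΞ]
    rw [hdiff, h3, h2, abs_mul, abs_of_pos (inv_pos.2 hN0)]
    have h4 := (Complex.abs_re_le_norm _).trans (norm_inner_le_norm (𝕜 := ℂ) (Ξ x) ((G ∘L Ξ) x))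
    set u := ‖Ξ x‖
    set v := ‖(G ∘L Ξ) x‖
    have h5 : N⁻¹ * |(inner ℂ (Ξ x) ((G ∘L Ξ) x)).re| ≤ N⁻¹ * (u * v) := by gcongr
    refine h5.trans ?_
    have e : t⁻¹ * t = 1 := inv_mul_cancel₀ ht.ne'
    have h6 : t / 2 * u ^ 2 + t⁻¹ * N⁻¹ ^ 2 / 2 * v ^ 2 - N⁻¹ * (u * v)
        = t⁻¹ / 2 * (t * u - N⁻¹ * v) ^ 2 + (1 - t⁻¹ * t) * (t / 2 * u ^ 2 - N⁻¹ * (u * v)) := by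
      ring
    have h7 : 0 ≤ t⁻¹ / 2 * (t * u - N⁻¹ * v) ^ 2 := by positivity
    rw [e, sub_self, zero_mul, add_zero] at h6
    linarith
  · rw [hP, posTrace_add h0 h1, posTrace_smul (by positivity), posTrace_smul (by positivity),
      posTrace_adjoint_comp_self, posTrace_adjoint_comp_self, hΞ1, mul_one]
    have h2 : hsSq (G ∘L Ξ) ≤ ENNReal.ofReal (N * (N * t ^ 2)) := by
      refine hG.trans ?_
      rw [ENNReal.ofReal_mul hN0.le, hN, ENNReal.ofReal_natCast]
      gcongr
      refine hLΩ.trans (ENNReal.ofReal_le_ofReal ?_)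
      rw [div_le_iff₀ hN0] at hμt
      linarith
    calc ENNReal.ofReal (t / 2) + ENNReal.ofReal (t⁻¹ * N⁻¹ ^ 2 / 2) * hsSq (G ∘L Ξ)
        ≤ ENNReal.ofReal (t / 2)
          + ENNReal.ofReal (t⁻¹ * N⁻¹ ^ 2 / 2) * ENNReal.ofReal (N * (N * t ^ 2)) := by gcongr
      _ = ENNReal.ofReal t := by
          rw [← ENNReal.ofReal_mul (by positivity), ← ENNReal.ofReal_add (by positivity)
            (by positivity)]
          congr 1
          field_simp
          ring

/-- The convex-split map does not increase the trace of a dominating operator. -/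
theorem exists_dominating_convexSplit_sub {σ : A →L[ℂ] A} {ρ ρ' P : HTensor A E →L[ℂ] HTensor A E}
    (hσ : IsState σ) (hP : 0 ≤ P) (hρ : IsSelfAdjoint (ρ - ρ'))
    (h : ∀ x, |(inner ℂ x ((ρ - ρ') x)).re| ≤ (inner ℂ x (P x)).re) (n : ℕ) :
    ∃ D : HPow A E (n + 1) →L[ℂ] HPow A E (n + 1), 0 ≤ D ∧
      (∀ x, |(inner ℂ x ((convexSplit σ ρ (n + 1) - convexSplit σ ρ' (n + 1)) x)).re|
        ≤ (inner ℂ x (D x)).re) ∧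
      posTrace D ≤ posTrace P := by
  have hPsa : IsSelfAdjoint P := hP.isSelfAdjoint
  -- Domination means that `P ± (ρ - ρ')` are both positive, and placing an operator next to copies
  -- of `σ` preserves positivity.
  have hplus : 0 ≤ P - (ρ - ρ') := nonneg_of_re_inner (hPsa.sub hρ) fun x => by
    rw [sub_apply, inner_sub_right, Complex.sub_re]
    linarith [(abs_le.1 (h x)).2]
  have hminus : 0 ≤ P - (ρ' - ρ) := nonneg_of_re_inner
    (hPsa.sub (by rw [← neg_sub]; exact hρ.neg)) fun x => by
    have h1 := (abs_le.1 (h x)).1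
    rw [sub_apply, inner_sub_right, Complex.sub_re] at h1
    rw [sub_apply, inner_sub_right, Complex.sub_re, sub_apply, inner_sub_right, Complex.sub_re]
    linarith
  set N : ℝ := ((n + 1 : ℕ) : ℝ) with hN
  have hN0 : 0 < N := by positivity
  have hnn : ∀ r : Fin (n + 1), 0 ≤ placeOp n r σ P := fun r => placeOp_nonneg n r hσ.1 hP
  have hsum : 0 ≤ ∑ r : Fin (n + 1), placeOp n r σ P := Finset.sum_nonneg fun r _ => hnn r
  have hcs : ∀ T : HTensor A E →L[ℂ] HTensor A E, ∀ x,
      (inner ℂ x (convexSplit σ T (n + 1) x)).re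
        = N⁻¹ * ∑ r : Fin (n + 1), (inner ℂ x (placeOp n r σ T x)).re := fun T x => by
    have h1 : convexSplit σ T (n + 1) = ((N⁻¹ : ℝ) : ℂ) • ∑ r : Fin (n + 1), placeOp n r σ T := by
      rw [convexSplit, hN]; push_cast; rw [one_div]
    rw [h1, smul_apply, inner_smul_right, Complex.re_ofReal_mul, sum_apply, inner_sum,
      Complex.re_sum]
  refine ⟨((N⁻¹ : ℝ) : ℂ) • ∑ r : Fin (n + 1), placeOp n r σ P, ?_, fun x => ?_, ?_⟩
  · rw [ContinuousLinearMap.nonneg_iff_isPositive] at hsum ⊢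
    exact hsum.smul_of_nonneg (by exact_mod_cast (inv_pos.2 hN0).le)
  · rw [smul_apply, inner_smul_right, Complex.re_ofReal_mul, sum_apply, inner_sum, Complex.re_sum,
      sub_apply, inner_sub_right, Complex.sub_re, hcs, hcs, ← mul_sub, abs_mul,
      abs_of_pos (inv_pos.2 hN0), ← Finset.sum_sub_distrib]
    gcongr
    refine (Finset.abs_sum_le_sum_abs _ _).trans (Finset.sum_le_sum fun r _ => ?_)
    have h1 := re_inner_nonneg (placeOp_nonneg n r hσ.1 hplus) x
    have h2 := re_inner_nonneg (placeOp_nonneg n r hσ.1 hminus) x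
    simp only [placeOp_sub, sub_apply, inner_sub_right, Complex.sub_re] at h1 h2
    exact abs_le.2 ⟨by linarith, by linarith⟩
  · rw [posTrace_smul (inv_pos.2 hN0).le, posTrace_sum _ hnn]
    calc ENNReal.ofReal N⁻¹ * ∑ r : Fin (n + 1), posTrace (placeOp n r σ P)
        ≤ ENNReal.ofReal N⁻¹ * ∑ _r : Fin (n + 1), posTrace P := by
          gcongr with r
          exact posTrace_placeOp_le n r hσ hP
      _ = posTrace P := by
          rw [Finset.sum_const, Finset.card_univ, Fintype.card_fin, nsmul_eq_mul, ← mul_assoc,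
            ← ENNReal.ofReal_natCast, ← ENNReal.ofReal_mul (inv_pos.2 hN0).le,
            inv_mul_cancel₀ hN0.ne', ENNReal.ofReal_one, one_mul]

end Decoupling

/-! ### Combination of the two errors and the smooth statement. -/

section SmoothConvexSplit

variable {A E : Type u} [NormedAddCommGroup A] [InnerProductSpace ℂ A] [CompleteSpace A]
  [NormedAddCommGroup E] [InnerProductSpace ℂ E] [CompleteSpace E]

theorem isSelfAdjoint_convexSplit {σ : A →L[ℂ] A} {ρ : HTensor A E →L[ℂ] HTensor A E}
    (hσ : 0 ≤ σ) (hρ : 0 ≤ ρ) (n : ℕ) : IsSelfAdjoint (convexSplit σ ρ (n + 1)) := by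
  have h : IsSelfAdjoint (∑ r : Fin (n + 1), placeOp n r σ ρ) :=
    (Finset.sum_nonneg fun r _ => placeOp_nonneg n r hσ hρ).isSelfAdjoint
  refine IsSelfAdjoint.smul ?_ h
  rw [isSelfAdjoint_iff]
  simp

theorem isSelfAdjoint_tensorPowOp {σ : A →L[ℂ] A} {T : E →L[ℂ] E}
    (hσ : 0 ≤ σ) (hT : 0 ≤ T) (n : ℕ) : IsSelfAdjoint (tensorPowOp n σ T) := by
  rw [ContinuousLinearMap.isSelfAdjoint_iff', adjoint_tensorPowOp, hσ.isSelfAdjoint.adjoint_eq,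
    hT.isSelfAdjoint.adjoint_eq]

/-- The triangle inequality is carried out on the dominating operators: `D` controls the change from
`ρ` to `ρ'`, and `P'` the convex-split error of `ρ'`. -/
theorem traceNorm_convexSplit_sub_le {ρ ρ' : HTensor A E →L[ℂ] HTensor A E} (hρ : IsState ρ)
    (hρ' : IsState ρ') {d t μ : ℝ} (hd : 0 < d) (ht : 0 < t) (hdist : sineDist ρ' ρ ≤ d)
    (hμ : 0 ≤ μ) (hle : ρ' ≤ (μ : ℂ) • opTensor (traceOutRight ρ) (traceOutLeft ρ')) (n : ℕ)
    (hμt : (μ - 1) / ((n + 1 : ℕ) : ℝ) ≤ t ^ 2) :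
    traceNorm (convexSplit (traceOutRight ρ) ρ (n + 1)
      - tensorPowOp (n + 1) (traceOutRight ρ) (traceOutLeft ρ')) ≤ ENNReal.ofReal (2 * d + t) := by
  have hσ := hρ.traceOutRight
  obtain ⟨P, hP, hPdom, hPtr⟩ := exists_dominating_of_sineDist_le hρ' hρ hd hdist
  obtain ⟨D, hD, hDdom, hDtr⟩ := exists_dominating_convexSplit_sub hσ hP
    (hρ'.1.isSelfAdjoint.sub hρ.1.isSelfAdjoint) hPdom n
  obtain ⟨P', hP', hPdom', hPtr'⟩ := exists_dominating_convexSplit hσ hρ' hμ hle n ht hμt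
  refine (traceNorm_le_posTrace (P := D + P') ((isSelfAdjoint_convexSplit hσ.1 hρ.1 n).sub
    (isSelfAdjoint_tensorPowOp hσ.1 hρ'.traceOutLeft.1 _)) (add_nonneg hD hP')
    fun x => ?_).trans ?_
  · have h1 := abs_le.1 (hDdom x)
    have h2 := abs_le.1 (hPdom' x)
    simp only [sub_apply, add_apply, inner_sub_right, inner_add_right, Complex.sub_re,
      Complex.add_re] at h1 h2 ⊢
    exact abs_le.2 ⟨by linarith [h1.2, h2.1], by linarith [h1.1, h2.2]⟩
  · rw [posTrace_add hD hP', ENNReal.ofReal_add (by positivity) ht.le]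
    exact add_le_add (hDtr.trans hPtr) hPtr'

/-- The strict inequality supplies a witness without any attainment of the infima over `ρ'` and over
the exponent `r`, where `μ = 2 ^ r`. -/
theorem exists_le_smul_of_smoothMaxMI_lt {ρ : HTensor A E →L[ℂ] HTensor A E} {δ x : ℝ}
    (hx : 0 < x) (h : smoothMaxMI δ ρ < ((Real.logb 2 x : ℝ) : EReal)) :
    ∃ (ρ' : HTensor A E →L[ℂ] HTensor A E) (μ : ℝ), IsState ρ' ∧ sineDist ρ' ρ ≤ δ ∧ 0 ≤ μ ∧
      μ < x ∧ ρ' ≤ (μ : ℂ) • opTensor (traceOutRight ρ) (traceOutLeft ρ') := by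
  simp only [smoothMaxMI, dMax, iInf_lt_iff] at h
  obtain ⟨ρ', hρ', hdist, r, hle, hr⟩ := h
  refine ⟨ρ', 2 ^ r, hρ', hdist, by positivity, ?_, hle⟩
  rw [EReal.coe_lt_coe_iff] at hr
  exact (Real.lt_logb_iff_rpow_lt one_lt_two hx).1 hr

end SmoothConvexSplit

end ConvexSplit

end

open ConvexSplit in
theorem mainTheorem8
    {A E : Type u}
    [NormedAddCommGroup A] [InnerProductSpace ℂ A] [CompleteSpace A]
    [TopologicalSpace.SeparableSpace A]
    [NormedAddCommGroup E] [InnerProductSpace ℂ E] [CompleteSpace E]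
    [TopologicalSpace.SeparableSpace E]
    {S : Type*} (ρ : S → (HTensor A E →L[ℂ] HTensor A E)) (ρA : A →L[ℂ] A)
    (hρ : ∀ s, IsState (ρ s)) (hρA : ∀ s, traceOutRight (ρ s) = ρA)
    (R : ℕ) (hR : 1 ≤ R) (ε η : ℝ) (hε : ε ∈ Set.Ioo (0 : ℝ) 1) (hη : η ∈ Set.Ioo (0 : ℝ) √ε)
    (hlog : (⨆ s, smoothMaxMI (√ε - η) (ρ s)) + ((2 * Real.logb 2 (1 / (2 * η)) : ℝ) : EReal)
      ≤ ((Real.logb 2 R : ℝ) : EReal)) :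
    ∀ s, ∃ ρE : E →L[ℂ] E, IsState ρE ∧
      (1 / 2 : ℝ≥0∞) * traceNorm (convexSplit ρA (ρ s) R - tensorPowOp R ρA ρE)
        ≤ ENNReal.ofReal √ε ∧
      sineDist ρE (traceOutLeft (ρ s)) ≤ √ε - η := by
  intro s
  obtain ⟨n, rfl⟩ : ∃ n, R = n + 1 := ⟨R - 1, by omega⟩
  obtain ⟨hη0, hηε⟩ := hη
  have hN : (0 : ℝ) < ((n + 1 : ℕ) : ℝ) := by positivity
  -- The assumption gives only `≤ log₂ (4 η² R)`. Adding `1` makes the inequality strict at no cost,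
  -- since the variance bound involves `μ - 1` and not `μ`.
  have hlt : smoothMaxMI (√ε - η) (ρ s)
      < ((Real.logb 2 (4 * η ^ 2 * ((n + 1 : ℕ) : ℝ) + 1) : ℝ) : EReal) := by
    have h1 : smoothMaxMI (√ε - η) (ρ s)
        ≤ ((Real.logb 2 ((n + 1 : ℕ) : ℝ) - 2 * Real.logb 2 (1 / (2 * η)) : ℝ) : EReal) := by
      rw [EReal.coe_sub]
      refine (EReal.le_sub_iff_add_le (Or.inl (EReal.coe_ne_bot _)) (Or.inl (EReal.coe_ne_top _))).2 ?_
      exact (add_le_add_left (le_iSup (fun s => smoothMaxMI (√ε - η) (ρ s)) s) _).trans hlog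
    refine h1.trans_lt (EReal.coe_lt_coe_iff.2 ?_)
    have h2 : Real.logb 2 ((n + 1 : ℕ) : ℝ) - 2 * Real.logb 2 (1 / (2 * η))
        = Real.logb 2 (4 * η ^ 2 * ((n + 1 : ℕ) : ℝ)) := by
      have h3 : (4 * η ^ 2 : ℝ) = (2 * η) ^ 2 := by ring
      rw [one_div, Real.logb_inv, h3, Real.logb_mul (by positivity) hN.ne', Real.logb_pow]
      push_cast
      ring
    rw [h2]
    exact Real.logb_lt_logb one_lt_two (by positivity) (by linarith)
  obtain ⟨ρ', μ, hρ', hdist, hμ, hμlt, hle⟩ :=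
    exists_le_smul_of_smoothMaxMI_lt (by positivity) hlt
  refine ⟨traceOutLeft ρ', hρ'.traceOutLeft, ?_, (sineDist_traceOutLeft_le hρ' (hρ s)).trans hdist⟩
  have hμt : (μ - 1) / ((n + 1 : ℕ) : ℝ) ≤ (2 * η) ^ 2 := by
    rw [div_le_iff₀ hN]
    linarith
  -- Here `d = √ε - η`, positive because `η < √ε`, and `t = 2 η`, so that `2 d + t = 2 √ε`.
  have h := traceNorm_convexSplit_sub_le (hρ s) hρ' (sub_pos.2 hηε) (mul_pos two_pos hη0) hdist hμ
    hle n hμt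
  rw [hρA] at h
  calc (1 / 2 : ℝ≥0∞) * traceNorm _ ≤ 1 / 2 * ENNReal.ofReal (2 * (√ε - η) + 2 * η) := by gcongr
    _ = ENNReal.ofReal √ε := by
        have h1 : 2 * (√ε - η) + 2 * η = 2 * √ε := by ring
        rw [h1, ENNReal.ofReal_mul zero_le_two, ← mul_assoc, one_div, ENNReal.ofReal_ofNat,
          ENNReal.inv_mul_cancel two_ne_zero (by simp), one_mul]
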